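/- **Definitions.** A 3-SAT formula is a finite conjunction of clauses, each a disjunction of three literals. An algebra $\mathbf A$ is idempotent if $g(x,\dots,x)\approx x$ for every basic operation $g$. For a subuniverse $B$ of $\mathbf A$, a pair $(C,D)$ is a $B$-blocker of $\mathbf A$ if $D\le\mathbf A$, $\emptyset\ne C\subset D$, $C\cap B=\emptyset$, $D\cap B\neq\emptyset$, and $D^n\setminus(D\setminus C)^n\le\mathbf A^n$ for every $n$. *Deciding singleton-blockers in idempotent CD algebras* is the following problem. Input: a finite idempotent algebra $\mathbf A$ that lies in a congruence distributive variety, with finitely many basic operations given by their tables, and an element $b\in A$. Question: does $\mathbf A$ have a $\{b\}$-blocker? For a 3-SAT formula $\psi=\bigwedge_{j=1}^m(\lambda_{j1}\vee\lambda_{j2}\vee\lambda_{j3})$ over variables $w_1,\dots,w_n$, let $\mathbf A_\psi$ be the algebra with universe $\{0,1,w_1,\dots,w_n\}$ and the basic operations $s_1,\dots,s_n$ (binary), $t_1,\dots,t_m,d_1,d_2$ (ternary), where - $s_i(x,x)=x$, $s_i(0,1)=w_i$, and $s_i(x,y)=1$ otherwise; - $t_j(x,x,x)=x$. For $p\in\{1,2,3\}$: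 if $\lambda_{jp}=w_k$, then $t_j=w_k$ on the triple whose $p$-th entry is $1$ and whose other entries are $w_k$; if $\lambda_{jp}=\neg w_k$, then $t_j=0$ on the triple whose $p$-th entry is $w_k$ and whose other entries are $0$. On all other triples $t_j=1$; - $d_1(x,y,z)=x$ if $x=y$ or $x=z$, and $d_1(x,y,z)=1$ otherwise; - $d_2(x,y,z)=z$ if $y=z$ or $x=z$, and $d_2(x,y,z)=1$ otherwise. **Theorem.** 1. For every 3-SAT formula $\psi$ over $w_1,\dots,w_n$, the algebra $\mathbf A_\psi$ is idempotent and lies in a congruence distributive variety, and $\mathbf A_\psi$ has a $\{0\}$-blocker if and only if $\psi$ is satisfiable. 2. There is a logarithmic-space many-one reduction $f$ from 3-SAT (variables indexed by arbitrary natural numbers, written in binary) to deciding singleton-blockers in idempotent CD algebras. That is, $f$ maps every formula $\varphi$ to an input of the latter problem, $\varphi$ is satisfiable if and only if the answer for $f(\varphi)$ is "Yes", and $f$ is computed by a deterministic Turing machine with a read-only input tape, a write-only output tape, and $O(\log N)$ cells of work space on inputs of length $N$. Moreover, $f$ can be chosen so that for every $\varphi$ one has $f(\varphi)=(\mathbf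 A_\psi,0)$ for some formula $\psi$ over some $w_1,\dots,w_n$ that becomes $\varphi$ under an injective renaming of the variables. -/

import Mathlib

/-! ### Logarithmic-space transducers and reductions -/

/-- Head moves. -/
inductive Move where
  | left
  | stay
  | right

/-- What the head on the read-only input tape can see: one of the two end markers that enclose the
input word, or a letter of the input word. -/
inductive InputCell (Γ : Type) where
  | leftEnd
  | rightEnd
  | letter (a : Γ)

/-- A deterministic Turing machine with a read-only input tape over `Γ`, finitely many two-way
infinite work tapes over a finite alphabet, and a write-only output tape over `Δ`.
Depending on the state and the scanned cells it halts (`none`), or it changes its state, moves the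
input head, writes on and moves along every work tape, and appends at most one letter to the
output. -/
structure Transducer (Γ Δ : Type) where
  State : Type
  finite_state : Finite State
  start : State
  tapes : ℕ
  Work : Type
  finite_work : Finite Work
  blank : Work
  δ : State → InputCell Γ → (Fin tapes → Work) →
    Option (State × Move × (Fin tapes → Work × Move) × Option Δ)

namespace Transducer

variable {Γ Δ : Type} (M : Transducer Γ Δ)

/-- Configurations of the machine (the input word is not part of them). Position `0` of the input
head is the left end marker, position `p + 1` is the letter number `p` of the input word. -/
structure Cfg where
  state : M.State
  inputPos : ℕ
  tape : Fin M.tapes → ℤ → M.Work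
  workPos : Fin M.tapes → ℤ
  output : List Δ

/-- The initial configuration: all work tapes are blank, and nothing has been written. -/
def init : M.Cfg where
  state := M.start
  inputPos := 0
  tape := fun _ _ => M.blank
  workPos := fun _ => 0
  output := []

/-- The cell of the input tape at position `p`. -/
def readInput (x : List Γ) : ℕ → InputCell Γ
  | 0 => .leftEnd
  | p + 1 => match x[p]? with
    | some a => .letter a
    | none => .rightEnd

/-- The input head never leaves the input word and its two end markers. -/
def moveInput (x : List Γ) (p : ℕ) : Move → ℕ
  | .left => p - 1
  | .stay => p
  | .right => min (p + 1) (x.length + 1)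

/-- Movement of a work head. -/
def moveWork (p : ℤ) : Move → ℤ
  | .left => p - 1
  | .stay => p
  | .right => p + 1

/-- One step of the computation on the input word `x`; `none` if the machine has halted. -/
def step (x : List Γ) (c : M.Cfg) : Option M.Cfg :=
  (M.δ c.state (readInput x c.inputPos) (fun i => c.tape i (c.workPos i))).map
    fun (q, m, w, o) =>
      { state := q
        inputPos := moveInput x c.inputPos m
        tape := fun i => Function.update (c.tape i) (c.workPos i) (w i).1
        workPos := fun i => moveWork (c.workPos i) (w i).2
        output := c.output ++ o.toList }

/-- On the input word `x` the machine halts with the output word `y`. -/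
def Outputs (x : List Γ) (y : List Δ) : Prop :=
  ∃ c ∈ StateTransition.eval (M.step x) M.init, c.output = y

/-- On the input word `x` the work heads visit only cells at distance at most `S` from their initial
cells. -/
def SpaceBoundedBy (x : List Γ) (S : ℕ) : Prop :=
  ∀ c, StateTransition.Reaches (M.step x) M.init c → ∀ i, |c.workPos i| ≤ S

end Transducer

/-- A decision problem: instances, their encoding by words over a finite alphabet, and the set of
instances whose answer is "Yes". -/
structure DecisionProblem where
  Instance : Type
  Symbol : Type
  finite_symbol : Finite Symbol
  encode : Instance → List Symbol
  encode_injective : Function.Injective encode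
  Yes : Instance → Prop

/-- `f` is computed by a Turing machine whose work space is `O(log n)` on encodings of length `n`. -/
def LogspaceComputable (P Q : DecisionProblem) (f : P.Instance → Q.Instance) : Prop :=
  ∃ (M : Transducer P.Symbol Q.Symbol) (c : ℕ), ∀ a : P.Instance,
    M.Outputs (P.encode a) (Q.encode (f a)) ∧
    M.SpaceBoundedBy (P.encode a) (c * Nat.log 2 (P.encode a).length + c)

/-- `f` is a logarithmic-space (many-one) reduction from `P` to `Q`. -/
def IsLogspaceReduction (P Q : DecisionProblem) (f : P.Instance → Q.Instance) : Prop :=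
  LogspaceComputable P Q f ∧ ∀ a, P.Yes a ↔ Q.Yes (f a)

/-! ### Words for lists of natural numbers -/

/-- The word for a list of natural numbers: every number is written in binary, least significant
digit first, and is followed by the separator `none`. -/
def encodeNats (l : List ℕ) : List (Option Bool) :=
  l.flatMap fun k => k.bits.map some ++ [none]

theorem append_none_inj {a b : List Bool} {r s : List (Option Bool)}
    (h : a.map some ++ none :: r = b.map some ++ none :: s) : a = b ∧ r = s := by
  induction a generalizing b with
  | nil => cases b <;> simp_all
  | cons x a ih =>
    cases b with
    | nil => simp at h
    | cons y b =>
      simp only [List.map_cons, List.cons_append, List.cons.injEq, Option.some.injEq] at h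
      obtain ⟨h1, h2⟩ := ih h.2
      simp [h.1, h1, h2]

theorem encodeNats_cons (k : ℕ) (l : List ℕ) :
    encodeNats (k :: l) = k.bits.map some ++ none :: encodeNats l := by
  simp [encodeNats]

theorem bits_inj {a b : ℕ} (h : a.bits = b.bits) : a = b := by
  have key : ∀ n : ℕ, n.bits.foldr Nat.bit 0 = n := by
    intro n
    induction n using Nat.binaryRec' with
    | zero => simp
    | bit b n hn ih => rw [Nat.bits_append_bit n b hn, List.foldr_cons, ih]
  rw [← key a, ← key b, h]

theorem encodeNats_injective : Function.Injective encodeNats := by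
  intro l
  induction l with
  | nil =>
    intro l' h
    cases l' with
    | nil => rfl
    | cons k l' =>
      rw [encodeNats_cons] at h
      simp [encodeNats] at h
  | cons k l ih =>
    intro l' h
    cases l' with
    | nil =>
      rw [encodeNats_cons] at h
      simp [encodeNats] at h
    | cons k' l' =>
      rw [encodeNats_cons, encodeNats_cons] at h
      obtain ⟨h1, h2⟩ := append_none_inj h
      rw [bits_inj h1, ih h2]

/-! ### 3-SAT -/

/-- A literal: a variable (`pos = true`) or a negated variable (`pos = false`). -/
@[ext]
structure Literal (V : Type) where
  var : V
  pos : Bool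

/-- A clause: a disjunction of three literals. -/
abbrev Clause (V : Type) : Type := Fin 3 → Literal V

/-- A 3-SAT formula: a conjunction of clauses of three literals. -/
abbrev ThreeCNF (V : Type) : Type := List (Clause V)

namespace ThreeCNF

/-- Some assignment makes at least one literal of every clause true. -/
def Satisfiable {V : Type} (φ : ThreeCNF V) : Prop :=
  ∃ e : V → Bool, ∀ cl ∈ φ, ∃ i, e (cl i).var = (cl i).pos

/-- Renaming of the variables of a formula. -/
def rename {V V' : Type} (r : V → V') (φ : ThreeCNF V) : ThreeCNF V' :=
  φ.map fun cl i => ⟨r (cl i).var, (cl i).pos⟩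

/-- A literal is written as its sign followed by the index of its variable. -/
def literalCode (l : Literal ℕ) : List ℕ := [l.pos.toNat, l.var]

/-- A formula is written as the list of its literals, clause by clause. -/
def code (φ : ThreeCNF ℕ) : List ℕ :=
  φ.flatMap fun cl => literalCode (cl 0) ++ literalCode (cl 1) ++ literalCode (cl 2)

theorem code_injective : Function.Injective code := by
  have hb : Function.Injective Bool.toNat := by decide
  intro φ
  induction φ with
  | nil => intro φ' h; cases φ' <;> simp_all [code, literalCode]
  | cons cl φ ih =>
    intro φ' h
    cases φ' with
    | nil => simp [code, literalCode] at h
    | cons cl' φ' =>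
      simp only [code, literalCode, List.flatMap_cons, List.cons_append, List.nil_append,
        List.cons.injEq] at h
      obtain ⟨a0, b0, a1, b1, a2, b2, h⟩ := h
      have hcl : cl = cl' := by
        funext i
        fin_cases i
        · exact Literal.ext b0 (hb a0)
        · exact Literal.ext b1 (hb a1)
        · exact Literal.ext b2 (hb a2)
      rw [hcl, ih h]

end ThreeCNF

/-- 3-SAT, with variables indexed by arbitrary natural numbers that are written in binary. -/
def threeSAT : DecisionProblem where
  Instance := ThreeCNF ℕ
  Symbol := Option Bool
  finite_symbol := inferInstance
  encode φ := encodeNats φ.code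
  encode_injective := encodeNats_injective.comp ThreeCNF.code_injective
  Yes φ := φ.Satisfiable

/-! ### Universal algebra -/


/-- `S` is closed under all basic operations. -/
def IsSubuniverse (L : FirstOrder.Language.{0, 0}) {A : Type} [L.Structure A] (S : Set A) : Prop :=
  ∀ (k : ℕ) (g : L.Functions k), FirstOrder.Language.ClosedUnder g S

/-- The power `Aⁿ`, with coordinatewise operations. -/
@[reducible]
def powerStructure (L : FirstOrder.Language.{0, 0}) (A : Type) [L.Structure A] (n : ℕ) :
    L.Structure (Fin n → A) where
  funMap g x := fun i => FirstOrder.Language.Structure.funMap g fun j => x j i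
  RelMap r x := ∀ i, FirstOrder.Language.Structure.RelMap r fun j => x j i

/-- `(C, D)` is a `B`-blocker of the algebra `A`. -/
structure IsBlocker (L : FirstOrder.Language.{0, 0}) {A : Type} [L.Structure A]
    (B C D : Set A) : Prop where
  subuniverse : IsSubuniverse L D
  nonempty : C.Nonempty
  subset : C ⊆ D
  disjoint : C ∩ B = ∅
  meets : (D ∩ B).Nonempty
  power : ∀ n : ℕ, @IsSubuniverse L (Fin n → A) (powerStructure L A n)
    ((Set.univ.pi fun _ => D) \ (Set.univ.pi fun _ => D \ C))

/-- The algebra `A` has a `B`-blocker. -/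
def HasBlocker (L : FirstOrder.Language.{0, 0}) {A : Type} [L.Structure A] (B : Set A) : Prop :=
  ∃ C D : Set A, IsBlocker L B C D

/-- Every basic operation `g` satisfies `g(x, …, x) ≈ x`. -/
def IsIdempotentAlgebra (L : FirstOrder.Language.{0, 0}) (A : Type) [L.Structure A] : Prop :=
  ∀ (k : ℕ) (g : L.Functions k) (x : A), FirstOrder.Language.Structure.funMap g (fun _ => x) = x

/-- Congruences of an algebra. -/
@[ext]
structure AlgCongruence (L : FirstOrder.Language.{0, 0}) (A : Type) [L.Structure A]
    extends Setoid A where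
  compat : ∀ {k : ℕ} (g : L.Functions k) (x y : Fin k → A), (∀ i, toSetoid (x i) (y i)) →
    toSetoid (FirstOrder.Language.Structure.funMap g x) (FirstOrder.Language.Structure.funMap g y)

namespace AlgCongruence

variable {L : FirstOrder.Language.{0, 0}} {A : Type} [L.Structure A]

/-- Congruences are ordered by inclusion. -/
instance : PartialOrder (AlgCongruence L A) :=
  PartialOrder.lift AlgCongruence.toSetoid fun _ _ h => AlgCongruence.ext (by rw [h])

/-- The infimum of a set of congruences is their intersection. -/
instance : InfSet (AlgCongruence L A) where
  sInf s :=
    { toSetoid := sInf (AlgCongruence.toSetoid '' s)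
      compat := by
        rintro k g x y h _ ⟨θ, hθ, rfl⟩
        exact θ.compat g x y fun i => h i θ.toSetoid ⟨θ, hθ, rfl⟩ }

theorem isGLB_sInf (s : Set (AlgCongruence L A)) : IsGLB s (sInf s) := by
  refine ⟨fun θ hθ => ?_, fun θ hθ => ?_⟩
  · change sInf (AlgCongruence.toSetoid '' s) ≤ θ.toSetoid
    exact sInf_le (Set.mem_image_of_mem _ hθ)
  · change θ.toSetoid ≤ sInf (AlgCongruence.toSetoid '' s)
    refine le_sInf ?_
    rintro _ ⟨η, hη, rfl⟩
    exact hθ hη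

/-- The congruence lattice. -/
instance : CompleteLattice (AlgCongruence L A) := completeLatticeOfInf _ isGLB_sInf

end AlgCongruence

/-- The congruence lattice of `A` is distributive. -/
def IsCongruenceDistributive (L : FirstOrder.Language.{0, 0}) (A : Type) [L.Structure A] : Prop :=
  ∀ α β γ : AlgCongruence L A, α ⊓ (β ⊔ γ) = (α ⊓ β) ⊔ (α ⊓ γ)

/-- `A` satisfies the identities `s ≈ t` for all `(s, t) ∈ E`, that is, `A` lies in the variety
defined by `E`. -/
def SatisfiesIdentities (L : FirstOrder.Language.{0, 0}) (E : Set (L.Term ℕ × L.Term ℕ)) (A : Type)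
    [L.Structure A] : Prop :=
  ∀ p ∈ E, ∀ v : ℕ → A, p.1.realize v = p.2.realize v

/-- `A` lies in a congruence distributive variety. -/
def InCongruenceDistributiveVariety (L : FirstOrder.Language.{0, 0}) (A : Type)
    [L.Structure A] : Prop :=
  ∃ E : Set (L.Term ℕ × L.Term ℕ), SatisfiesIdentities L E A ∧
    ∀ (M : Type) [L.Structure M], SatisfiesIdentities L E M → IsCongruenceDistributive L M

/-! ### Algebras given by tables -/

/-- A finite algebra with universe `{0, …, card - 1}` and a finite list of basic operations, each
given by its arity and its values. -/
structure TableAlgebra where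
  card : ℕ
  ops : List (Σ k : ℕ, (Fin k → Fin card) → Fin card)

namespace TableAlgebra

/-- The signature of an algebra: one symbol for every operation in the list. -/
def lang (A : TableAlgebra) : FirstOrder.Language.{0, 0} where
  Functions k := {i : Fin A.ops.length // (A.ops.get i).1 = k}
  Relations _ := Empty

instance (A : TableAlgebra) : A.lang.Structure (Fin A.card) where
  funMap g x := (A.ops.get g.1).2 fun j => x (Fin.cast g.2 j)
  RelMap r _ := r.elim

/-- An operation is written as its arity followed by its table: all its values, where the first
argument varies fastest. -/
def opCode {N : ℕ} (g : Σ k : ℕ, (Fin k → Fin N) → Fin N) : List ℕ :=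
  g.1 :: List.ofFn fun j : Fin (N ^ g.1) => (g.2 (finFunctionFinEquiv.symm j)).val

theorem opsCode_injective {N : ℕ} :
    Function.Injective fun l : List (Σ k : ℕ, (Fin k → Fin N) → Fin N) => l.flatMap opCode := by
  intro l
  induction l with
  | nil => intro l' h; cases l' <;> simp_all [opCode]
  | cons g l ih =>
    intro l' h
    cases l' with
    | nil => simp [opCode] at h
    | cons g' l' =>
      obtain ⟨k, g⟩ := g
      obtain ⟨k', g'⟩ := g'
      simp only [List.flatMap_cons, opCode, List.cons_append, List.cons.injEq] at h
      obtain ⟨rfl, h⟩ := h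
      obtain ⟨h1, h2⟩ := List.append_inj h (by simp)
      have hg : g = g' := by
        funext x
        have h3 := congrFun (List.ofFn_injective h1) (finFunctionFinEquiv x)
        simpa [Fin.val_inj] using h3
      rw [hg, ih h2]

end TableAlgebra

/-- An input of the problem "deciding singleton-blockers in idempotent CD algebras": a finite
idempotent algebra in a congruence distributive variety, and an element `b` of it. -/
structure SingletonBlockerInstance where
  alg : TableAlgebra
  b : Fin alg.card
  idempotent : IsIdempotentAlgebra alg.lang (Fin alg.card)
  distributive : InCongruenceDistributiveVariety alg.lang (Fin alg.card)

namespace SingletonBlockerInstance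

/-- An input is written as the size of the universe, the element `b`, and the operations. -/
def code (I : SingletonBlockerInstance) : List ℕ :=
  I.alg.card :: I.b.val :: I.alg.ops.flatMap TableAlgebra.opCode

theorem code_injective : Function.Injective code := by
  rintro ⟨⟨N, l⟩, b, h1, h2⟩ ⟨⟨N', l'⟩, b', h1', h2'⟩ h
  simp only [code, List.cons.injEq] at h
  obtain ⟨rfl, hb, hl⟩ := h
  obtain rfl := TableAlgebra.opsCode_injective hl
  obtain rfl := Fin.val_injective hb
  rfl

end SingletonBlockerInstance

/-- Deciding singleton-blockers in idempotent CD algebras: does the algebra have a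
`{b}`-blocker? -/
def singletonBlockerProblem : DecisionProblem where
  Instance := SingletonBlockerInstance
  Symbol := Option Bool
  finite_symbol := inferInstance
  encode I := encodeNats I.code
  encode_injective := encodeNats_injective.comp SingletonBlockerInstance.code_injective
  Yes I := HasBlocker I.alg.lang ({I.b} : Set (Fin I.alg.card))

/-! ### The algebra of a 3-SAT formula over the variables `w_1, …, w_n` -/

namespace SatAlgebra

variable {n : ℕ}

/-- The element `w_i` of the universe `{0, 1, w_1, …, w_n}`, which is represented by `Fin (n + 2)`
(with `w_i` numbered from `i = 0`). -/
def w (i : Fin n) : Fin (n + 2) := i.succ.succ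

/-- The operation `s_i`. -/
def s (i : Fin n) (x y : Fin (n + 2)) : Fin (n + 2) :=
  if x = y then x
  else if x = 0 ∧ y = 1 then w i
  else 1

/-- The operation `t_j` that belongs to the clause `cl`. -/
def t (cl : Clause (Fin n)) (x y z : Fin (n + 2)) : Fin (n + 2) :=
  let u : Fin 3 → Fin (n + 2) := fun i => w (cl i).var
  if x = y ∧ y = z then x
  else if (cl 0).pos = true ∧ y = u 0 ∧ z = u 0 ∧ x = 1 then u 0
  else if (cl 1).pos = true ∧ x = u 1 ∧ z = u 1 ∧ y = 1 then u 1
  else if (cl 2).pos = true ∧ x = u 2 ∧ y = u 2 ∧ z = 1 then u 2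
  else if (cl 0).pos = false ∧ x = u 0 ∧ y = 0 ∧ z = 0 then 0
  else if (cl 1).pos = false ∧ y = u 1 ∧ x = 0 ∧ z = 0 then 0
  else if (cl 2).pos = false ∧ z = u 2 ∧ x = 0 ∧ y = 0 then 0
  else 1

/-- The operation `d_1`. -/
def d₁ (x y z : Fin (n + 2)) : Fin (n + 2) := if x = y ∨ x = z then x else 1

/-- The operation `d_2`. -/
def d₂ (x y z : Fin (n + 2)) : Fin (n + 2) := if y = z ∨ x = z then z else 1

/-- A binary operation, as an entry of a list of operations. -/
def binary {N : ℕ} (g : Fin N → Fin N → Fin N) : Σ k : ℕ, (Fin k → Fin N) → Fin N :=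
  ⟨2, fun x => g (x 0) (x 1)⟩

/-- A ternary operation, as an entry of a list of operations. -/
def ternary {N : ℕ} (g : Fin N → Fin N → Fin N → Fin N) : Σ k : ℕ, (Fin k → Fin N) → Fin N :=
  ⟨3, fun x => g (x 0) (x 1) (x 2)⟩

end SatAlgebra

/-- The algebra on `{0, 1, w_1, …, w_n}` with the basic operations `s_1, …, s_n`, `t_1, …, t_m`,
`d_1`, `d_2` that belongs to a formula with `m` clauses. -/
def satAlgebra {n : ℕ} (ψ : ThreeCNF (Fin n)) : TableAlgebra where
  card := n + 2
  ops := List.ofFn (fun i => SatAlgebra.binary (SatAlgebra.s i)) ++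
    ψ.map (fun cl => SatAlgebra.ternary (SatAlgebra.t cl)) ++
    [SatAlgebra.ternary SatAlgebra.d₁, SatAlgebra.ternary SatAlgebra.d₂]

/-- The element `0` of the algebra of a formula. -/
def satZero {n : ℕ} (ψ : ThreeCNF (Fin n)) : Fin (satAlgebra ψ).card := (0 : Fin (n + 2))

/-!
The first part rests on absorbing coordinates. The set of tuples over `D` with an entry in `C` is
closed under an operation `g` of all powers exactly if `g` has a coordinate `p` such that `g x ∈ C`
whenever `x p ∈ C` (`isBlocker_iff`). The operations `s_i` force `1 ∈ C` and `D = A` for every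
`{0}`-blocker `(C, D)`, so that `C` is determined by the assignment `w_k ↦ [w_k ∈ C]`, and coordinate
`p` of `t_j` is absorbing exactly if this assignment makes the literal number `p` of the clause true
(`SatAlgebra.t_absorbing`, `SatAlgebra.literal_of_t_absorbing`). The operations `d_1`, `d_2` are
directed Jónsson terms, which make all algebras that satisfy their identities congruence
distributive (`DirectedJonsson.isCongruenceDistributive`).

For the reduction, the variables of a formula have to be renamed to `w_i` with small `i`, although
they are too long to be stored in logarithmic space. With `N` the length of the input word, the
universe gets `N + 1` elements `w_i`, and a variable gets as its index the first position of the input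
at which its binary word, followed by a separator, occurs (`firstPos`). This index is injective since
a position determines the word that starts there, and it can be found by comparing input symbols with
two pointers into the input. Indices that no variable uses do no harm (`Reduction.oldVar`).

The machine is obtained in three layers. Structured programs whose tests and actions see one input
cell and one work cell are compiled to transducers (`Prog.Exec.outputs_and_spaceBoundedBy`). On top
of them, the tracks of the work tape hold registers in binary; incrementing, clearing, printing,
comparing and loading an input symbol are such programs, and `RegProg.Runs` describes their exact
effect as long as all registers stay below a bound, in space logarithmic in the bound. Finally,
`Reduction.main` is a program in these instructions that prints the algebra of the renamed formula
(`Reduction.runs_main`), and all its registers are at most `N + 3`.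
-/

/-! ### Directed Jónsson operations and congruence distributivity -/

open FirstOrder Language in
/-- The basic operations `f`, `g` are directed Jónsson operations of `A` (in a chain of length two). -/
def DirectedJonsson (L : FirstOrder.Language.{0, 0}) (f g : L.Functions 3) (A : Type)
    [L.Structure A] : Prop :=
  ∀ x y : A, Structure.funMap f ![x, x, y] = x ∧ Structure.funMap f ![x, y, x] = x ∧
    Structure.funMap f ![x, y, y] = Structure.funMap g ![x, x, y] ∧
    Structure.funMap g ![x, y, x] = x ∧ Structure.funMap g ![x, y, y] = y

namespace AlgCongruence

variable {L : FirstOrder.Language.{0, 0}} {A : Type} [L.Structure A]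

open FirstOrder.Language (Structure)

/-- The join of two congruences in the lattice of equivalence relations is again a congruence,
because the arguments of an operation can be changed one at a time. -/
def supSetoid (β γ : AlgCongruence L A) : AlgCongruence L A where
  toSetoid := β.toSetoid ⊔ γ.toSetoid
  compat := by
    intro k g x y h
    set θ := β.toSetoid ⊔ γ.toSetoid
    have one : ∀ (z : Fin k → A) (i : Fin k) (a b : A), θ a b →
        θ (Structure.funMap g (Function.update z i a))
          (Structure.funMap g (Function.update z i b)) := by
      intro z i a b hab
      rw [show θ = _ from Setoid.sup_eq_eqvGen _ _] at hab
      induction hab with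
      | rel a b hab =>
        rcases hab with hab | hab
        · refine (le_sup_left : β.toSetoid ≤ θ) (β.compat g _ _ fun j => ?_)
          rcases eq_or_ne j i with rfl | hj
          · simpa using hab
          · simp [hj]
        · refine (le_sup_right : γ.toSetoid ≤ θ) (γ.compat g _ _ fun j => ?_)
          rcases eq_or_ne j i with rfl | hj
          · simpa using hab
          · simp [hj]
      | refl a => exact θ.refl _
      | symm a b _ ih => exact θ.symm ih
      | trans a b c _ _ ih1 ih2 => exact θ.trans ih1 ih2
    have many : ∀ s : Finset (Fin k),
        θ (Structure.funMap g x) (Structure.funMap g (s.piecewise y x)) := by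
      intro s
      induction s using Finset.induction_on with
      | empty => simp
      | insert i s hi ih =>
        refine θ.trans ih ?_
        have := one (s.piecewise y x) i (x i) (y i) (h i)
        rwa [← Finset.piecewise_insert, Function.update_eq_self_iff.2 (by simp [hi])] at this
    simpa using many Finset.univ

/-- Congruences have the same join as in the lattice of equivalence relations. -/
theorem sup_rel_iff (β γ : AlgCongruence L A) (a b : A) :
    (β ⊔ γ).toSetoid a b ↔ Relation.EqvGen (fun u v => β.toSetoid u v ∨ γ.toSetoid u v) a b := by
  have h1 : β ⊔ γ ≤ supSetoid β γ :=
    sup_le (show β.toSetoid ≤ β.toSetoid ⊔ γ.toSetoid from le_sup_left)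
      (show γ.toSetoid ≤ β.toSetoid ⊔ γ.toSetoid from le_sup_right)
  have h2 : β.toSetoid ⊔ γ.toSetoid ≤ (β ⊔ γ).toSetoid :=
    sup_le (show β ≤ β ⊔ γ from le_sup_left) (show γ ≤ β ⊔ γ from le_sup_right)
  have h3 : (β ⊔ γ).toSetoid = β.toSetoid ⊔ γ.toSetoid :=
    le_antisymm (show β ⊔ γ ≤ supSetoid β γ from h1) h2
  rw [h3, Setoid.sup_eq_eqvGen]
  rfl

/-- The infimum of two congruences is their intersection. -/
theorem inf_rel {α β : AlgCongruence L A} {a b : A} (h1 : α.toSetoid a b) (h2 : β.toSetoid a b) :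
    (α ⊓ β).toSetoid a b := by
  let η : AlgCongruence L A :=
    { toSetoid := α.toSetoid ⊓ β.toSetoid
      compat := fun g x y h =>
        ⟨α.compat g x y fun i => (h i).1, β.compat g x y fun i => (h i).2⟩ }
  have h : η ≤ α ⊓ β :=
    le_inf (show α.toSetoid ⊓ β.toSetoid ≤ α.toSetoid from inf_le_left)
      (show α.toSetoid ⊓ β.toSetoid ≤ β.toSetoid from inf_le_right)
  exact h ⟨h1, h2⟩

/-- If `a α c` and `a (β ∨ γ) c`, then a ternary operation `p` with `p(x, y, x) ≈ x` maps a
`β`-`γ`-chain from `a` to `c` to an `(α ∧ β)`-`(α ∧ γ)`-chain from `p(a, a, c)` to `p(a, c, c)`. -/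
theorem funMap_rel {α β γ : AlgCongruence L A} (p : L.Functions 3)
    (hp : ∀ x y : A, Structure.funMap p ![x, y, x] = x) {a c : A} (hα : α.toSetoid a c) {u v : A}
    (h : Relation.EqvGen (fun u v => β.toSetoid u v ∨ γ.toSetoid u v) u v) :
    ((α ⊓ β) ⊔ (α ⊓ γ)).toSetoid (Structure.funMap p ![a, u, c])
      (Structure.funMap p ![a, v, c]) := by
  set θ := (α ⊓ β) ⊔ (α ⊓ γ)
  have toA : ∀ u, α.toSetoid (Structure.funMap p ![a, u, c]) a := by
    intro u
    have := α.compat p ![a, u, c] ![a, u, a] (by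
      intro i
      fin_cases i
      · exact α.refl _
      · exact α.refl _
      · exact α.symm hα)
    rwa [hp] at this
  have aux : ∀ (η : AlgCongruence L A) (u v : A), η.toSetoid u v →
      (α ⊓ η).toSetoid (Structure.funMap p ![a, u, c]) (Structure.funMap p ![a, v, c]) := by
    intro η u v huv
    refine inf_rel (α.trans (toA u) (α.symm (toA v))) (η.compat p _ _ fun i => ?_)
    fin_cases i
    · exact η.refl _
    · exact huv
    · exact η.refl _
  induction h with
  | rel u v huv =>
    rcases huv with huv | huv
    · exact (le_sup_left : α ⊓ β ≤ θ) (aux β u v huv)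
    · exact (le_sup_right : α ⊓ γ ≤ θ) (aux γ u v huv)
  | refl u => exact θ.refl _
  | symm u v _ ih => exact θ.symm ih
  | trans u v w _ _ ih1 ih2 => exact θ.trans ih1 ih2

end AlgCongruence

/-- If `a α c` and `a (β ∨ γ) c`, then `a = f(a, a, c)`, `f(a, c, c) = g(a, a, c)` and
`g(a, c, c) = c` are related by `(α ∧ β) ∨ (α ∧ γ)` one after the other. -/
theorem DirectedJonsson.isCongruenceDistributive {L : FirstOrder.Language.{0, 0}}
    {f g : L.Functions 3} {A : Type} [L.Structure A] (h : DirectedJonsson L f g A) :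
    IsCongruenceDistributive L A := by
  intro α β γ
  refine le_antisymm ?_ le_inf_sup
  intro a c hac
  have h1 : α.toSetoid a c := (inf_le_left : α ⊓ (β ⊔ γ) ≤ α) hac
  have h2 := (AlgCongruence.sup_rel_iff β γ a c).1 ((inf_le_right : α ⊓ (β ⊔ γ) ≤ β ⊔ γ) hac)
  have hf := AlgCongruence.funMap_rel f (fun x y => (h x y).2.1) h1 h2
  have hg := AlgCongruence.funMap_rel g (fun x y => (h x y).2.2.2.1) h1 h2
  rw [(h a c).1, (h a c).2.2.1] at hf
  rw [(h a c).2.2.2.2] at hg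
  exact ((α ⊓ β) ⊔ (α ⊓ γ)).trans hf hg

open FirstOrder Language in
/-- The identities of `DirectedJonsson`. -/
def directedJonssonIdentities (L : FirstOrder.Language.{0, 0}) (f g : L.Functions 3) :
    Set (L.Term ℕ × L.Term ℕ) :=
  let x : L.Term ℕ := .var 0
  let y : L.Term ℕ := .var 1
  {(.func f ![x, x, y], x), (.func f ![x, y, x], x), (.func f ![x, y, y], .func g ![x, x, y]),
    (.func g ![x, y, x], x), (.func g ![x, y, y], y)}

theorem satisfiesIdentities_directedJonsson {L : FirstOrder.Language.{0, 0}} {f g : L.Functions 3}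
    {A : Type} [L.Structure A] :
    SatisfiesIdentities L (directedJonssonIdentities L f g) A ↔ DirectedJonsson L f g A := by
  have e3 : ∀ (v : ℕ → A) (a b c : L.Term ℕ),
      (fun i => FirstOrder.Language.Term.realize v (![a, b, c] i)) =
        ![a.realize v, b.realize v, c.realize v] := by
    intro v a b c
    funext i
    fin_cases i <;> rfl
  constructor
  · intro h x y
    let v : ℕ → A := fun i => if i = 0 then x else y
    simp only [SatisfiesIdentities, directedJonssonIdentities, Set.mem_insert_iff,
      Set.mem_singleton_iff, forall_eq_or_imp, forall_eq, FirstOrder.Language.Term.realize, e3] at h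
    obtain ⟨h1, h2, h3, h4, h5⟩ := h
    exact ⟨h1 v, h2 v, h3 v, h4 v, h5 v⟩
  · intro h
    simp only [SatisfiesIdentities, directedJonssonIdentities, Set.mem_insert_iff,
      Set.mem_singleton_iff, forall_eq_or_imp, forall_eq, FirstOrder.Language.Term.realize, e3]
    exact ⟨fun v => (h _ _).1, fun v => (h _ _).2.1, fun v => (h _ _).2.2.1,
      fun v => (h _ _).2.2.2.1, fun v => (h _ _).2.2.2.2⟩

theorem DirectedJonsson.inCongruenceDistributiveVariety {L : FirstOrder.Language.{0, 0}}
    {f g : L.Functions 3} {A : Type} [L.Structure A] (h : DirectedJonsson L f g A) :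
    InCongruenceDistributiveVariety L A :=
  ⟨directedJonssonIdentities L f g, satisfiesIdentities_directedJonsson.2 h, fun _ _ hM =>
    (satisfiesIdentities_directedJonsson.1 hM).isCongruenceDistributive⟩

/-! ### Blockers and absorbing coordinates -/

/-- The set of tuples over `D` with an entry in `C` is closed under the operation `g` of all powers
if and only if some coordinate `p` of `g` is absorbing: `g x ∈ C` as soon as `x p ∈ C`. -/
theorem isBlocker_iff {L : FirstOrder.Language.{0, 0}} {A : Type} [L.Structure A] {B C D : Set A} :
    IsBlocker L B C D ↔ IsSubuniverse L D ∧ C.Nonempty ∧ C ⊆ D ∧ C ∩ B = ∅ ∧ (D ∩ B).Nonempty ∧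
      ∀ (k : ℕ) (g : L.Functions k), ∃ p : Fin k, ∀ x : Fin k → A, (∀ i, x i ∈ D) → x p ∈ C →
        FirstOrder.Language.Structure.funMap g x ∈ C := by
  constructor
  · rintro ⟨h1, h2, h3, h4, h5, h6⟩
    refine ⟨h1, h2, h3, h4, h5, fun k g => ?_⟩
    by_contra! hcon
    choose x hxD hxC hgx using hcon
    -- The counterexamples for the `k` coordinates are the rows of a matrix whose columns are tuples
    -- with an entry in `C`, on the diagonal.
    have := h6 k k g (fun q p => x p q) (by
      intro q
      refine ⟨fun p _ => hxD p q, fun hq => ?_⟩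
      exact (hq q trivial).2 (hxC q))
    exact this.2 fun p _ => ⟨this.1 p trivial, hgx p⟩
  · rintro ⟨h1, h2, h3, h4, h5, h6⟩
    refine ⟨h1, h2, h3, h4, h5, fun n k g y hy => ?_⟩
    obtain ⟨p, hp⟩ := h6 k g
    refine ⟨fun i _ => h1 k g _ fun j => (hy j).1 i trivial, fun hcon => (hy p).2 ?_⟩
    intro i _
    refine ⟨(hy p).1 i trivial, fun hC => (hcon i trivial).2 ?_⟩
    exact hp _ (fun j => (hy j).1 i trivial) hC

/-! ### The basic operations of an algebra given by tables -/

namespace TableAlgebra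

theorem funMap_eq (A : TableAlgebra) {k : ℕ} (g : A.lang.Functions k)
    {h : (Fin k → Fin A.card) → Fin A.card} (e : A.ops.get g.1 = ⟨k, h⟩)
    (x : Fin k → Fin A.card) : FirstOrder.Language.Structure.funMap g x = h x := by
  have aux : ∀ (o : Σ k : ℕ, (Fin k → Fin A.card) → Fin A.card) (p : o.1 = k), o = ⟨k, h⟩ →
      o.2 (fun j => x (Fin.cast p j)) = h x := by
    rintro _ p rfl
    rfl
  exact aux _ g.2 e

theorem exists_symbol (A : TableAlgebra) {k : ℕ} {h : (Fin k → Fin A.card) → Fin A.card}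
    (hm : (⟨k, h⟩ : Σ k : ℕ, (Fin k → Fin A.card) → Fin A.card) ∈ A.ops) :
    ∃ g : A.lang.Functions k, ∀ x : Fin k → Fin A.card,
      FirstOrder.Language.Structure.funMap g x = h x := by
  obtain ⟨i, hi⟩ := List.get_of_mem hm
  have e : (A.ops.get i).1 = k := by rw [hi]
  exact ⟨⟨i, e⟩, A.funMap_eq ⟨i, e⟩ hi⟩

theorem exists_op (A : TableAlgebra) {k : ℕ} (g : A.lang.Functions k) :
    ∃ h : (Fin k → Fin A.card) → Fin A.card,
      (⟨k, h⟩ : Σ k : ℕ, (Fin k → Fin A.card) → Fin A.card) ∈ A.ops ∧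
      ∀ x : Fin k → Fin A.card, FirstOrder.Language.Structure.funMap g x = h x := by
  obtain ⟨i, rfl⟩ := g
  exact ⟨(A.ops.get i).2, List.get_mem _ _, fun x => A.funMap_eq _ rfl x⟩

end TableAlgebra

/-! ### The algebra of a formula -/

namespace SatAlgebra

variable {n : ℕ}

theorem mem_ops {ψ : ThreeCNF (Fin n)} {o : Σ k : ℕ, (Fin k → Fin (n + 2)) → Fin (n + 2)} :
    o ∈ (satAlgebra ψ).ops ↔ ((∃ i, binary (s i) = o) ∨ ∃ cl ∈ ψ, ternary (t cl) = o) ∨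
      o = ternary d₁ ∨ o = ternary d₂ := by
  change o ∈ (List.ofFn (fun i => binary (s i)) ++ ψ.map (fun cl => ternary (t cl)) ++
    [ternary d₁, ternary d₂] : List (Σ k : ℕ, (Fin k → Fin (n + 2)) → Fin (n + 2))) ↔ _
  simp only [List.mem_append, List.mem_ofFn, List.mem_map, List.mem_cons, List.not_mem_nil,
    or_false]

/-- A property of the operations of the algebra of a formula holds if it holds for each of
`s_i`, `t_j`, `d_1`, `d_2`. -/
theorem forall_op {ψ : ThreeCNF (Fin n)}
    {P : ∀ k : ℕ, ((Fin k → Fin (n + 2)) → Fin (n + 2)) → Prop}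
    (hs : ∀ i, P 2 fun x => s i (x 0) (x 1))
    (ht : ∀ cl ∈ ψ, P 3 fun x => t cl (x 0) (x 1) (x 2))
    (h₁ : P 3 fun x => d₁ (x 0) (x 1) (x 2)) (h₂ : P 3 fun x => d₂ (x 0) (x 1) (x 2)) :
    ∀ o ∈ (satAlgebra ψ).ops, P o.1 o.2 := by
  intro o ho
  rcases mem_ops.1 ho with (⟨i, rfl⟩ | ⟨cl, hcl, rfl⟩) | rfl | rfl
  · exact hs i
  · exact ht cl hcl
  · exact h₁
  · exact h₂

theorem d₁_mem (ψ : ThreeCNF (Fin n)) : ternary d₁ ∈ (satAlgebra ψ).ops :=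
  mem_ops.2 (Or.inr (Or.inl rfl))

theorem d₂_mem (ψ : ThreeCNF (Fin n)) : ternary d₂ ∈ (satAlgebra ψ).ops :=
  mem_ops.2 (Or.inr (Or.inr rfl))

theorem s_mem (ψ : ThreeCNF (Fin n)) (i : Fin n) : binary (s i) ∈ (satAlgebra ψ).ops :=
  mem_ops.2 (Or.inl (Or.inl ⟨i, rfl⟩))

theorem t_mem {ψ : ThreeCNF (Fin n)} {cl : Clause (Fin n)} (h : cl ∈ ψ) :
    ternary (t cl) ∈ (satAlgebra ψ).ops :=
  mem_ops.2 (Or.inl (Or.inr ⟨cl, h, rfl⟩))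

theorem w_ne_zero (i : Fin n) : w i ≠ 0 := Fin.succ_ne_zero _

theorem w_ne_one (i : Fin n) : w i ≠ 1 := by
  intro h
  simp [w, Fin.ext_iff] at h

theorem zero_ne_one : (0 : Fin (n + 2)) ≠ 1 := by simp

theorem eq_zero_or_one_or_w (a : Fin (n + 2)) : a = 0 ∨ a = 1 ∨ ∃ i, a = w i := by
  refine Fin.cases (Or.inl rfl) (fun b => Or.inr ?_) a
  exact Fin.cases (Or.inl rfl) (fun i => Or.inr ⟨i, rfl⟩) b

theorem isIdempotentAlgebra (ψ : ThreeCNF (Fin n)) :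
    IsIdempotentAlgebra (satAlgebra ψ).lang (Fin (satAlgebra ψ).card) := by
  intro k g x
  obtain ⟨h, hm, hg⟩ := (satAlgebra ψ).exists_op g
  rw [hg]
  exact forall_op (P := fun k h => ∀ x : Fin (n + 2), h (fun _ => x) = x)
    (by simp [s]) (by simp [t]) (by simp [d₁]) (by simp [d₂]) _ hm x

theorem inCongruenceDistributiveVariety (ψ : ThreeCNF (Fin n)) :
    InCongruenceDistributiveVariety (satAlgebra ψ).lang (Fin (satAlgebra ψ).card) := by
  obtain ⟨f, hf⟩ := (satAlgebra ψ).exists_symbol (d₁_mem ψ)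
  obtain ⟨g, hg⟩ := (satAlgebra ψ).exists_symbol (d₂_mem ψ)
  refine DirectedJonsson.inCongruenceDistributiveVariety (f := f) (g := g) ?_
  have key : ∀ x y : Fin (n + 2), d₁ x x y = x ∧ d₁ x y x = x ∧ d₁ x y y = d₂ x x y ∧
      d₂ x y x = x ∧ d₂ x y y = y := by
    intro x y
    refine ⟨by simp [d₁], by simp [d₁], ?_, by simp [d₂], by simp [d₂]⟩
    simp only [d₁, d₂, or_self]
    split_ifs with h
    · exact h
    · rfl
  intro x y
  simp only [hf, hg]
  exact key x y

/-- The conditions under which the value of `t_j` lies in a set `C` with `0 ∉ C`, `1 ∈ C`: if the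
literal number `p` is true under the assignment `w_k ↦ [w_k ∈ C]`, then coordinate `p` of `t_j` is
absorbing for `C`. -/
theorem t_absorbing {C : Set (Fin (n + 2))} (h1 : (1 : Fin (n + 2)) ∈ C) (h0 : (0 : Fin (n + 2)) ∉ C)
    {cl : Clause (Fin n)} {p : Fin 3} (hp : w (cl p).var ∈ C ↔ (cl p).pos = true)
    (x : Fin 3 → Fin (n + 2)) (hx : x p ∈ C) : t cl (x 0) (x 1) (x 2) ∈ C := by
  have hw := fun i : Fin n => w_ne_zero i
  have hw1 := fun i : Fin n => w_ne_one i
  unfold t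
  fin_cases p <;> simp only [Fin.zero_eta, Fin.mk_one, Fin.reduceFinMk] at hp hx <;>
    dsimp only <;> split_ifs <;> grind

/-- If coordinate `p` of `t_j` is absorbing for `C`, then the literal number `p` is true under the
assignment `w_k ↦ [w_k ∈ C]`. -/
theorem literal_of_t_absorbing {C : Set (Fin (n + 2))} (h1 : (1 : Fin (n + 2)) ∈ C)
    (h0 : (0 : Fin (n + 2)) ∉ C) {cl : Clause (Fin n)} {p : Fin 3}
    (h : ∀ x : Fin 3 → Fin (n + 2), x p ∈ C → t cl (x 0) (x 1) (x 2) ∈ C) :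
    w (cl p).var ∈ C ↔ (cl p).pos = true := by
  have hw := w_ne_zero (cl p).var
  have hw1 := w_ne_one (cl p).var
  have h01 := zero_ne_one (n := n)
  cases hpos : (cl p).pos with
  | true =>
    have := h (Function.update (fun _ => w (cl p).var) p 1) (by simpa using h1)
    simp only [iff_true]
    fin_cases p <;> simp [t, Function.update] at this hpos ⊢ <;> grind
  | false =>
    simp only [Bool.false_eq_true, iff_false]
    intro hC
    have := h (Function.update (fun _ => 0) p (w (cl p).var)) (by simpa using hC)
    fin_cases p <;> simp [t, Function.update] at this hpos <;> grind

/-- A satisfying assignment `e` gives the blocker `(C, A)` with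
`C = {1} ∪ {w_k : e(w_k) is true}`. -/
theorem hasBlocker_of_satisfiable {ψ : ThreeCNF (Fin n)} (h : ψ.Satisfiable) :
    HasBlocker (satAlgebra ψ).lang ({satZero ψ} : Set (Fin (satAlgebra ψ).card)) := by
  classical
  obtain ⟨e, he⟩ := h
  let C : Set (Fin (n + 2)) := {a | a = 1 ∨ ∃ i, e i = true ∧ a = w i}
  have h1 : (1 : Fin (n + 2)) ∈ C := Or.inl rfl
  have h0 : (0 : Fin (n + 2)) ∉ C := by
    rintro (h | ⟨i, -, h⟩)
    · exact zero_ne_one h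
    · exact w_ne_zero i h.symm
  have hw : ∀ i, w i ∈ C ↔ e i = true := by
    intro i
    refine ⟨?_, fun h => Or.inr ⟨i, h, rfl⟩⟩
    rintro (h | ⟨j, hj, h⟩)
    · exact absurd h (w_ne_one i)
    · rwa [show i = j from by simpa [w] using h]
  refine ⟨C, Set.univ, isBlocker_iff.2 ⟨fun _ _ _ _ => trivial, ⟨_, h1⟩, Set.subset_univ _, ?_,
    ⟨satZero ψ, trivial, rfl⟩, fun k g => ?_⟩⟩
  · refine Set.eq_empty_of_forall_notMem ?_
    rintro a ⟨haC, rfl⟩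
    exact h0 haC
  · obtain ⟨h, hm, hg⟩ := (satAlgebra ψ).exists_op g
    simp only [hg, Set.mem_univ, implies_true, forall_const]
    refine forall_op (P := fun k h => ∃ p : Fin k, ∀ x : Fin k → Fin (n + 2), x p ∈ C → h x ∈ C)
      ?_ ?_ ?_ ?_ _ hm
    · intro i
      by_cases hi : w i ∈ C
      · refine ⟨1, fun x hx => ?_⟩
        simp only [s]
        split_ifs with h
        · rwa [h]
        · exact hi
        · exact h1
      · refine ⟨0, fun x hx => ?_⟩
        simp only [s]
        split_ifs with h h'
        · exact hx
        · exact absurd (h'.1 ▸ hx) h0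
        · exact h1
    · intro cl hcl
      obtain ⟨p, hp⟩ := he cl hcl
      exact ⟨p, fun x hx => t_absorbing h1 h0 (by rw [hw, hp]) x hx⟩
    · refine ⟨0, fun x hx => ?_⟩
      simp only [d₁]
      split_ifs
      · exact hx
      · exact h1
    · refine ⟨2, fun x hx => ?_⟩
      simp only [d₂]
      split_ifs
      · exact hx
      · exact h1

/-- A `{0}`-blocker `(C, D)` has `1 ∈ C` and `D = A`, by the operations `s_i`. Hence `C` defines an
assignment, and the absorbing coordinate of `t_j` is a true literal of the clause. -/
theorem satisfiable_of_hasBlocker {ψ : ThreeCNF (Fin n)}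
    (h : HasBlocker (satAlgebra ψ).lang ({satZero ψ} : Set (Fin (satAlgebra ψ).card))) :
    ψ.Satisfiable := by
  classical
  obtain ⟨C, D, hb⟩ := h
  obtain ⟨hD, ⟨c, hc⟩, hCD, hC0, ⟨z, hzD, rfl⟩, hop⟩ := isBlocker_iff.1 hb
  change Set (Fin (n + 2)) at C D
  change Fin (n + 2) at c
  have h0 : (0 : Fin (n + 2)) ∉ C := fun h => (hC0 ▸ ⟨h, rfl⟩ : (0 : Fin (n + 2)) ∈ (∅ : Set _))
  have h0D : (0 : Fin (n + 2)) ∈ D := hzD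
  have hcD : c ∈ D := hCD hc
  have hc0 : c ≠ 0 := fun h => h0 (h ▸ hc)
  rcases Nat.eq_zero_or_pos n with rfl | hn
  · exact ⟨fun _ => true, fun cl _ => (cl 0).var.elim0⟩
  have op : ∀ (k : ℕ) (h : (Fin k → Fin (n + 2)) → Fin (n + 2)),
      (⟨k, h⟩ : Σ k : ℕ, (Fin k → Fin (n + 2)) → Fin (n + 2)) ∈ (satAlgebra ψ).ops →
      (∀ x : Fin k → Fin (n + 2), (∀ i, x i ∈ D) → h x ∈ D) ∧
      ∃ p : Fin k, ∀ x : Fin k → Fin (n + 2), (∀ i, x i ∈ D) → x p ∈ C → h x ∈ C := by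
    intro k h hm
    obtain ⟨g, hg⟩ := (satAlgebra ψ).exists_symbol hm
    refine ⟨fun x hx => hg x ▸ hD k g x hx, ?_⟩
    obtain ⟨p, hp⟩ := hop k g
    exact ⟨p, fun x hx hxp => hg x ▸ hp x hx hxp⟩
  have h1 : (1 : Fin (n + 2)) ∈ C := by
    obtain ⟨-, p, hp⟩ := op _ _ (s_mem ψ ⟨0, hn⟩)
    by_cases hc1 : c = 1
    · exact hc1 ▸ hc
    fin_cases p
    · simpa [s, hc0] using hp ![c, 0] (by simp [Fin.forall_fin_two, hcD, h0D]) hc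
    · simpa [s, hc0.symm, hc1] using hp ![0, c] (by simp [Fin.forall_fin_two, hcD, h0D]) hc
  have h1D : (1 : Fin (n + 2)) ∈ D := hCD h1
  have hwD : ∀ i, w i ∈ D := by
    intro i
    simpa [s, zero_ne_one] using
      (op _ _ (s_mem ψ i)).1 ![0, 1] (by simp [Fin.forall_fin_two, h1D, h0D])
  have hall : ∀ a, a ∈ D := by
    intro a
    rcases eq_zero_or_one_or_w a with rfl | rfl | ⟨i, rfl⟩
    exacts [h0D, h1D, hwD i]
  refine ⟨fun i => decide (w i ∈ C), fun cl hcl => ?_⟩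
  obtain ⟨-, p, hp⟩ := op _ _ (t_mem hcl)
  refine ⟨p, ?_⟩
  have := literal_of_t_absorbing h1 h0 fun x hx => hp x (fun i => hall _) hx
  rw [Bool.eq_iff_iff, decide_eq_true_iff, this]

end SatAlgebra

/-! ### Structured programs for transducers with one work tape -/

/-- Structured programs for a transducer with one work tape over the alphabet `W`. All decisions
depend only on the scanned input cell and the scanned work cell. -/
inductive Prog (Γ W Δ : Type) where
  /-- Move the input head, write on the work tape and move its head, output at most one letter. -/
  | act (f : InputCell Γ → W → Move × W × Move × Option Δ)
  | seq (a b : Prog Γ W Δ)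
  /-- If `t` holds then run `a`, else run `b`. -/
  | cond (t : InputCell Γ → W → Bool) (a b : Prog Γ W Δ)
  /-- While `t` holds, run `a`. -/
  | loop (t : InputCell Γ → W → Bool) (a : Prog Γ W Δ)

/-- What a program acts on: a configuration of a transducer with one work tape, without the
state. -/
@[ext]
structure Store (W Δ : Type) where
  inputPos : ℕ
  tape : ℤ → W
  pos : ℤ
  output : List Δ

namespace Store

variable {Γ W Δ : Type}

/-- The scanned input cell. -/
def input (d : Store W Δ) (x : List Γ) : InputCell Γ := Transducer.readInput x d.inputPos

/-- The scanned work cell. -/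
def scan (d : Store W Δ) : W := d.tape d.pos

/-- The effect of a single action. -/
def apply (x : List Γ) (d : Store W Δ) (r : Move × W × Move × Option Δ) : Store W Δ where
  inputPos := Transducer.moveInput x d.inputPos r.1
  tape := Function.update d.tape d.pos r.2.1
  pos := Transducer.moveWork d.pos r.2.2.1
  output := d.output ++ r.2.2.2.toList

theorem apply_stay (x : List Γ) (d : Store W Δ) :
    d.apply x (.stay, d.scan, .stay, none) = d := by
  simp [apply, scan, Transducer.moveInput, Transducer.moveWork]

end Store

namespace Prog

variable {Γ W Δ : Type}

/-- `Exec x S c d d'`: on the input word `x`, the program `c` started in `d` terminates in `d'`, and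
the work head stays within distance `S` of the origin. -/
inductive Exec (x : List Γ) (S : ℕ) : Prog Γ W Δ → Store W Δ → Store W Δ → Prop
  | act {f} {d : Store W Δ} (h : |(d.apply x (f (d.input x) d.scan)).pos| ≤ S) :
      Exec x S (.act f) d (d.apply x (f (d.input x) d.scan))
  | seq {a b : Prog Γ W Δ} {d d₁ d₂ : Store W Δ} (ha : Exec x S a d d₁) (hb : Exec x S b d₁ d₂) :
      Exec x S (.seq a b) d d₂
  | cond_true {t} {a b : Prog Γ W Δ} {d d' : Store W Δ} (ht : t (d.input x) d.scan = true)
      (h : Exec x S a d d') : Exec x S (.cond t a b) d d'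
  | cond_false {t} {a b : Prog Γ W Δ} {d d' : Store W Δ} (ht : t (d.input x) d.scan = false)
      (h : Exec x S b d d') : Exec x S (.cond t a b) d d'
  | loop_true {t} {a : Prog Γ W Δ} {d d₁ d₂ : Store W Δ} (ht : t (d.input x) d.scan = true)
      (ha : Exec x S a d d₁) (h : Exec x S (.loop t a) d₁ d₂) : Exec x S (.loop t a) d d₂
  | loop_false {t} {a : Prog Γ W Δ} {d : Store W Δ} (ht : t (d.input x) d.scan = false) :
      Exec x S (.loop t a) d d

/-- The control states of a program while it is running. A conditional and a loop have one state
(`none`) for the test. -/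
def State : Prog Γ W Δ → Type
  | act _ => Unit
  | seq a b => a.State ⊕ b.State
  | cond _ a b => Option (a.State ⊕ b.State)
  | loop _ a => Option a.State

theorem finite_state : ∀ c : Prog Γ W Δ, Finite c.State
  | act _ => inferInstanceAs (Finite Unit)
  | seq a b =>
    have := a.finite_state
    have := b.finite_state
    inferInstanceAs (Finite (a.State ⊕ b.State))
  | cond _ a b =>
    have := a.finite_state
    have := b.finite_state
    inferInstanceAs (Finite (Option (a.State ⊕ b.State)))
  | loop _ a =>
    have := a.finite_state
    inferInstanceAs (Finite (Option a.State))

/-- The first control state. -/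
def first : ∀ c : Prog Γ W Δ, c.State
  | act _ => ()
  | seq a _ => Sum.inl a.first
  | cond _ _ _ => none
  | loop _ _ => none

/-- One step of the control: the next state (`none` at the end of the program) and the action. -/
def next : ∀ c : Prog Γ W Δ, c.State → InputCell Γ → W →
    Option c.State × (Move × W × Move × Option Δ)
  | act f, _, i, w => (none, f i w)
  | seq a b, Sum.inl s, i, w =>
    (some ((a.next s i w).1.elim (Sum.inr b.first) Sum.inl), (a.next s i w).2)
  | seq _ b, Sum.inr s, i, w => ((b.next s i w).1.map Sum.inr, (b.next s i w).2)
  | cond t a b, none, i, w =>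
    (some (some (if t i w then Sum.inl a.first else Sum.inr b.first)), (.stay, w, .stay, none))
  | cond _ a _, some (Sum.inl s), i, w =>
    ((a.next s i w).1.map (some ∘ Sum.inl), (a.next s i w).2)
  | cond _ _ b, some (Sum.inr s), i, w =>
    ((b.next s i w).1.map (some ∘ Sum.inr), (b.next s i w).2)
  | loop t a, none, i, w =>
    (if t i w then some (some a.first) else none, (.stay, w, .stay, none))
  | loop _ a, some s, i, w => (some (a.next s i w).1, (a.next s i w).2)

/-- A step of the control of `c` on a store that moves the work head to a cell at distance at most
`S` from the origin. -/
def Step (x : List Γ) (S : ℕ) (c : Prog Γ W Δ) (p q : Option c.State × Store W Δ) : Prop :=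
  ∃ s, p.1 = some s ∧ q = ((c.next s (p.2.input x) p.2.scan).1,
    p.2.apply x (c.next s (p.2.input x) p.2.scan).2) ∧ |q.2.pos| ≤ S

/-- A run of a part `a` of a program `c` is a run of `c`, where `g` embeds the states. -/
theorem Step.lift {x : List Γ} {S : ℕ} {a c : Prog Γ W Δ} (g : Option a.State → Option c.State)
    (hg : ∀ s i w, ∃ s', g (some s) = some s' ∧
      c.next s' i w = (g (a.next s i w).1, (a.next s i w).2))
    {p q : Option a.State × Store W Δ} (h : Relation.ReflTransGen (Step x S a) p q) :
    Relation.ReflTransGen (Step x S c) (g p.1, p.2) (g q.1, q.2) := by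
  refine Relation.ReflTransGen.lift (fun p : Option a.State × Store W Δ => (g p.1, p.2)) ?_ _ _ h
  rintro ⟨_, d⟩ q ⟨s, rfl, rfl, hS⟩
  obtain ⟨s', h1, h2⟩ := hg s (d.input x) d.scan
  exact ⟨s', h1, by simp [h2], hS⟩

/-- A step of the control that leaves the store unchanged. -/
theorem Step.test {x : List Γ} {S : ℕ} {c : Prog Γ W Δ} {s : c.State} {o : Option c.State}
    {d : Store W Δ} (hd : |d.pos| ≤ S)
    (h : c.next s (d.input x) d.scan = (o, (.stay, d.scan, .stay, none))) :
    Step x S c (some s, d) (o, d) :=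
  ⟨s, rfl, by simp [h, d.apply_stay], hd⟩

/-- Correctness of the compilation: an execution of a program is a run of its control, within the
same space. -/
theorem Exec.steps {x : List Γ} {S : ℕ} {c : Prog Γ W Δ} {d d' : Store W Δ} (h : Exec x S c d d') :
    |d.pos| ≤ S → |d'.pos| ≤ S ∧ Relation.ReflTransGen (Step x S c) (some c.first, d) (none, d') := by
  induction h with
  | act h => exact fun _ => ⟨h, .single ⟨(), rfl, rfl, h⟩⟩
  | @seq a b d d₁ d₂ _ _ iha ihb =>
    intro hd
    obtain ⟨hd₁, h1⟩ := iha hd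
    obtain ⟨hd₂, h2⟩ := ihb hd₁
    have h1' := Step.lift (c := .seq a b)
      (fun o => some (o.elim (Sum.inr b.first) Sum.inl)) (fun s i w => ⟨Sum.inl s, rfl, rfl⟩) h1
    have h2' := Step.lift (c := .seq a b) (Option.map Sum.inr)
      (fun s i w => ⟨Sum.inr s, rfl, rfl⟩) h2
    exact ⟨hd₂, h1'.trans h2'⟩
  | @cond_true t a b d d' ht _ ih =>
    intro hd
    obtain ⟨hd', h⟩ := ih hd
    have h' := Step.lift (c := .cond t a b) (Option.map (some ∘ Sum.inl))
      (fun s i w => ⟨some (Sum.inl s), rfl, rfl⟩) h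
    exact ⟨hd', h'.head (Step.test hd (by simp [next, first, ht]; rfl))⟩
  | @cond_false t a b d d' ht _ ih =>
    intro hd
    obtain ⟨hd', h⟩ := ih hd
    have h' := Step.lift (c := .cond t a b) (Option.map (some ∘ Sum.inr))
      (fun s i w => ⟨some (Sum.inr s), rfl, rfl⟩) h
    exact ⟨hd', h'.head (Step.test hd (by simp [next, first, ht]; rfl))⟩
  | @loop_true t a d d₁ d₂ ht _ _ iha ih =>
    intro hd
    obtain ⟨hd₁, h1⟩ := iha hd
    obtain ⟨hd₂, h2⟩ := ih hd₁
    have h1' := Step.lift (c := .loop t a) some (fun s i w => ⟨some s, rfl, rfl⟩) h1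
    exact ⟨hd₂, (h1'.head (Step.test hd (by simp [next, first, ht]; rfl))).trans h2⟩
  | @loop_false t a d ht =>
    exact fun hd => ⟨hd, .single (Step.test hd (by simp [next, first, ht]))⟩

/-- The transducer that runs a program. Its state `none` is the halting state. -/
def toTransducer [Finite W] (c : Prog Γ W Δ) (blank : W) : Transducer Γ Δ where
  State := Option c.State
  finite_state :=
    have := c.finite_state
    inferInstance
  start := some c.first
  tapes := 1
  Work := W
  finite_work := inferInstance
  blank := blank
  δ q i w := q.map fun s =>
    let r := c.next s i (w 0)
    (r.1, r.2.1, fun _ => (r.2.2.1, r.2.2.2.1), r.2.2.2.2)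

/-- The initial store. -/
def _root_.Store.initial (blank : W) : Store W Δ := ⟨0, fun _ => blank, 0, []⟩

/-- A terminating execution within space `S` gives the output of the transducer and bounds its
space. -/
theorem Exec.outputs_and_spaceBoundedBy [Finite W] {x : List Γ} {S : ℕ} {c : Prog Γ W Δ} {blank : W}
    {d : Store W Δ} (h : Exec x S c (Store.initial blank) d) :
    (c.toTransducer blank).Outputs x d.output ∧ (c.toTransducer blank).SpaceBoundedBy x S := by
  set M := c.toTransducer blank
  let toCfg : Option c.State × Store W Δ → M.Cfg := fun p =>
    ⟨p.1, p.2.inputPos, fun _ => p.2.tape, fun _ => p.2.pos, p.2.output⟩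
  have hstep : ∀ p q, Step x S c p q → M.step x (toCfg p) = some (toCfg q) := by
    rintro ⟨_, d⟩ q ⟨s, rfl, rfl, -⟩
    rfl
  have hhalt : ∀ d : Store W Δ, M.step x (toCfg (none, d)) = none := fun d => rfl
  have h0 : |(Store.initial blank : Store W Δ).pos| ≤ S := by simp [Store.initial]
  obtain ⟨hd, hrun⟩ := h.steps h0
  constructor
  · refine ⟨toCfg (none, d), ?_, rfl⟩
    refine StateTransition.mem_eval.2 ⟨?_, hhalt d⟩
    exact Relation.ReflTransGen.lift (p := fun a b => b ∈ M.step x a) toCfg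
      (fun p q hpq => hstep p q hpq) _ _ hrun
  · -- Since the machine is deterministic, every reachable configuration lies on this run.
    have key : ∀ p : Option c.State × Store W Δ,
        Relation.ReflTransGen (Step x S c) p (none, d) → |p.2.pos| ≤ S →
        ∀ e, StateTransition.Reaches (M.step x) (toCfg p) e → ∀ i, |e.workPos i| ≤ S := by
      intro p hp
      induction hp using Relation.ReflTransGen.head_induction_on with
      | refl =>
        intro hpos e he i
        rcases Relation.ReflTransGen.cases_head he with rfl | ⟨e', he', -⟩
        · exact hpos
        · simp [hhalt d] at he'
      | head hab hbc ih =>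
        intro hpos e he i
        rcases Relation.ReflTransGen.cases_head he with rfl | ⟨e', he', hr⟩
        · exact hpos
        · rw [hstep _ _ hab, Option.mem_some_iff] at he'
          subst he'
          refine ih ?_ e hr i
          obtain ⟨s, -, -, hS⟩ := hab
          exact hS
    exact key _ hrun h0

end Prog

/-! ### Arithmetic of binary words -/

/-- The binary successor, least significant digit first. -/
def incBits : List Bool → List Bool
  | [] => [true]
  | false :: l => true :: l
  | true :: l => false :: incBits l

theorem bits_succ (n : ℕ) : (n + 1).bits = incBits n.bits := by
  induction n using Nat.binaryRec' with
  | zero => simp [incBits]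
  | bit b n hn ih =>
    rw [Nat.bits_append_bit n b hn]
    cases b with
    | false =>
      rw [show Nat.bit false n + 1 = Nat.bit true n from by simp [Nat.bit_val],
        Nat.bits_append_bit n true (by simp)]
      rfl
    | true =>
      rw [show Nat.bit true n + 1 = Nat.bit false (n + 1) from by simp [Nat.bit_val]; ring,
        Nat.bits_append_bit (n + 1) false (by simp), ih]
      rfl

/-- The position at which the carry of `incBits` stops. -/
def carryPos : List Bool → ℕ
  | true :: l => carryPos l + 1
  | _ => 0

theorem carryPos_le : ∀ l : List Bool, carryPos l ≤ l.length
  | [] => le_rfl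
  | false :: _ => Nat.zero_le _
  | true :: l => by simpa [carryPos] using carryPos_le l

theorem getElem?_of_lt_carryPos : ∀ (l : List Bool) (j : ℕ), j < carryPos l → l[j]? = some true
  | [], _, h => by simp [carryPos] at h
  | false :: _, _, h => by simp [carryPos] at h
  | true :: _, 0, _ => rfl
  | true :: l, j + 1, h => by
    simpa using getElem?_of_lt_carryPos l j (by simpa [carryPos] using h)

theorem getElem?_carryPos : ∀ l : List Bool, l[carryPos l]? ≠ some true
  | [] => by simp
  | false :: _ => by simp [carryPos]
  | true :: l => by simpa [carryPos] using getElem?_carryPos l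

theorem incBits_getElem? : ∀ (l : List Bool) (j : ℕ), (incBits l)[j]? =
    if j < carryPos l then some false else if j = carryPos l then some true else l[j]?
  | [], 0 => rfl
  | [], j + 1 => by simp [incBits, carryPos]
  | false :: _, 0 => rfl
  | false :: _, j + 1 => by simp [incBits, carryPos]
  | true :: _, 0 => by simp [incBits, carryPos]
  | true :: l, j + 1 => by simpa [incBits, carryPos] using incBits_getElem? l j

/-- The first position at which two words differ or end. -/
def diffPos : List Bool → List Bool → ℕ
  | a :: l, b :: l' => if a = b then diffPos l l' + 1 else 0
  | _, _ => 0

theorem diffPos_le : ∀ l l' : List Bool, diffPos l l' ≤ l.length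
  | [], _ => Nat.zero_le _
  | _ :: _, [] => Nat.zero_le _
  | a :: l, b :: l' => by
    unfold diffPos
    split_ifs
    · simpa using diffPos_le l l'
    · exact Nat.zero_le _

theorem getElem?_of_lt_diffPos : ∀ (l l' : List Bool) (j : ℕ), j < diffPos l l' →
    l[j]? = l'[j]? ∧ l[j]?.isSome
  | [], _, _, h => by simp [diffPos] at h
  | _ :: _, [], _, h => by simp [diffPos] at h
  | a :: l, b :: l', j, h => by
    unfold diffPos at h
    split_ifs at h with hab
    · cases j with
      | zero => simp [hab]
      | succ j => simpa using getElem?_of_lt_diffPos l l' j (by omega)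
    · omega

/-- At the first position at which two words differ or end, equal entries mean that both words have
ended. -/
theorem getElem?_diffPos : ∀ l l' : List Bool,
    (l[diffPos l l']? = l'[diffPos l l']? ↔ l = l') ∧
      ¬(l[diffPos l l']? = l'[diffPos l l']? ∧ l[diffPos l l']?.isSome)
  | [], [] => by simp
  | [], _ :: _ => by simp [diffPos]
  | _ :: _, [] => by simp [diffPos]
  | a :: l, b :: l' => by
    unfold diffPos
    split_ifs with hab
    · simpa [hab] using getElem?_diffPos l l'
    · simp [hab]

/-! ### Registers on the tracks of a work tape -/

/-- A work cell: a column with one entry on each track, or the marker (`none`) of the cell at the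
origin. The track of every register holds its value in binary, least significant digit first. -/
abbrev Cell (R : Type) : Type := Option (R → Option Bool)

/-- Programs that work on registers named by `R`. -/
abbrev RegProg (R : Type) : Type := Prog (Option Bool) (Cell R) (Option Bool)

namespace RegProg

variable {R : Type}

/-- The tape with the marker at the origin and with the tracks `T` to the right of it. -/
def tapeOf (T : R → ℕ → Option Bool) : ℤ → Cell R
  | .ofNat 0 => none
  | .ofNat (k + 1) => some fun r => T r k
  | .negSucc _ => some fun _ => none

/-- A store whose work tape has the tracks `T`. -/
def onTracks (T : R → ℕ → Option Bool) (p k : ℕ) (o : List (Option Bool)) :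
    Store (Cell R) (Option Bool) :=
  ⟨p, tapeOf T, k, o⟩

/-- The tracks for the register contents `v`. -/
def tracks (v : R → ℕ) (r : R) (k : ℕ) : Option Bool := (v r).bits[k]?

/-- The canonical store for the register contents `v`: the work head is at the first column. -/
def regs (v : R → ℕ) (p : ℕ) (o : List (Option Bool)) : Store (Cell R) (Option Bool) :=
  onTracks (tracks v) p 1 o

/-- The entry of a work cell on the track `r`. -/
def entry (r : R) (w : Cell R) : Option Bool := w.bind fun c => c r

/-- Move the work head back to the first column. -/
def home : RegProg R :=
  .seq (.loop (fun _ w => w.isSome) (.act fun _ w => (.stay, w, .left, none)))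
    (.act fun _ w => (.stay, w, .right, none))

/-- Move the work head to the right as long as the scanned column satisfies `t`, rewriting the
columns by `g` and writing the output `out`. -/
def sweep (t : (R → Option Bool) → Bool) (g : (R → Option Bool) → R → Option Bool)
    (out : (R → Option Bool) → Option (Option Bool)) : RegProg R :=
  .loop (fun _ w => w.any t) (.act fun _ w => (.stay, w.map g, .right, w.bind out))

variable {x : List (Option Bool)} {S : ℕ}

/-- The effect of an action that rewrites the column number `k` and moves to the right: the new tracks
`T'` differ from the old ones at most in this column. -/
theorem apply_right (T T' : R → ℕ → Option Bool) (p k : ℕ) (o : List (Option Bool))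
    (out : Option (Option Bool)) (h : ∀ r j, j ≠ k → T' r j = T r j) :
    (onTracks T p (k + 1) o).apply x (.stay, some fun r => T' r k, .right, out) =
      onTracks T' p (k + 2) (o ++ out.toList) := by
  refine Store.ext rfl ?_ ?_ rfl
  · funext z
    change Function.update (tapeOf T) ((k + 1 : ℕ) : ℤ) _ z = tapeOf T' z
    match z with
    | .negSucc z => rfl
    | .ofNat 0 => rfl
    | .ofNat (j + 1) =>
      rcases eq_or_ne j k with rfl | hj
      · exact Function.update_self ..
      · rw [Function.update_of_ne (by simpa using hj)]
        change some _ = some _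
        congr 1
        funext r
        exact (h r j hj).symm
  · change ((k + 1 : ℕ) : ℤ) + 1 = ((k + 2 : ℕ) : ℤ)
    push_cast
    ring

theorem exec_home (T : R → ℕ → Option Bool) (p k : ℕ) (o : List (Option Bool)) (hk : k ≤ S)
    (hS : 1 ≤ S) : Prog.Exec x S home (onTracks T p k o) (onTracks T p 1 o) := by
  have h1 : ∀ k ≤ S, Prog.Exec x S
      (.loop (fun _ w => w.isSome) (.act fun _ w => (.stay, w, .left, none)))
      (onTracks T p k o) (onTracks T p 0 o) := by
    intro k
    induction k with
    | zero => exact fun _ => .loop_false rfl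
    | succ k ih =>
      intro hk
      refine .loop_true rfl ?_ (ih (by omega))
      have e : (onTracks T p (k + 1) o).apply x
          (.stay, (onTracks T p (k + 1) o).scan, .left, none) = onTracks T p k o := by
        refine Store.ext rfl (Function.update_eq_self _ _) ?_ (List.append_nil _)
        change ((k + 1 : ℕ) : ℤ) - 1 = (k : ℤ)
        push_cast
        ring
      rw [← e]
      refine .act ?_
      rw [e]
      change |(k : ℤ)| ≤ S
      rw [Nat.abs_cast]
      exact_mod_cast (by omega : k ≤ S)
  refine .seq (h1 k hk) ?_
  have e : (onTracks T p 0 o).apply x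
      (.stay, (onTracks T p 0 o).scan, .right, none) = onTracks T p 1 o :=
    Store.ext rfl (Function.update_eq_self _ _) rfl (List.append_nil _)
  rw [← e]
  refine .act ?_
  rw [e]
  change |((1 : ℕ) : ℤ)| ≤ S
  rw [Nat.abs_cast]
  exact_mod_cast hS

/-- `apply_right` as an execution of a program. -/
theorem exec_right {f} (T T' : R → ℕ → Option Bool) (p k : ℕ) (o : List (Option Bool))
    (out : Option (Option Bool)) (h : ∀ r j, j ≠ k → T' r j = T r j)
    (hf : ∀ i, f i (some fun r => T r k) = (.stay, some fun r => T' r k, .right, out))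
    (hk : k + 2 ≤ S) :
    Prog.Exec x S (.act f) (onTracks T p (k + 1) o) (onTracks T' p (k + 2) (o ++ out.toList)) := by
  have e : (onTracks T p (k + 1) o).apply x (f ((onTracks T p (k + 1) o).input x)
      (onTracks T p (k + 1) o).scan) = onTracks T' p (k + 2) (o ++ out.toList) := by
    rw [show (onTracks T p (k + 1) o).scan = some fun r => T r k from rfl, hf,
      apply_right T T' p k o out h]
  rw [← e]
  refine .act ?_
  rw [e]
  change |((k + 2 : ℕ) : ℤ)| ≤ S
  rw [Nat.abs_cast]
  exact_mod_cast hk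

/-- The sweep stops at the first column `m` that does not satisfy `t`. -/
theorem exec_sweep {t : (R → Option Bool) → Bool} {g : (R → Option Bool) → R → Option Bool}
    {out : (R → Option Bool) → Option (Option Bool)} (T : R → ℕ → Option Bool) (p m : ℕ)
    (o : List (Option Bool)) (ht : ∀ j < m, t (fun r => T r j) = true)
    (hm : t (fun r => T r m) = false) (hS : m + 1 ≤ S) :
    Prog.Exec x S (sweep t g out) (onTracks T p 1 o)
      (onTracks (fun r j => if j < m then g (fun r => T r j) r else T r j) p (m + 1)
        (o ++ (List.range m).flatMap fun j => (out fun r => T r j).toList)) := by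
  suffices h : ∀ d i, i + d = m → Prog.Exec x S (sweep t g out)
      (onTracks (fun r j => if j < i then g (fun r => T r j) r else T r j) p (i + 1)
        (o ++ (List.range i).flatMap fun j => (out fun r => T r j).toList))
      (onTracks (fun r j => if j < m then g (fun r => T r j) r else T r j) p (m + 1)
        (o ++ (List.range m).flatMap fun j => (out fun r => T r j).toList)) by
    simpa using h m 0 (by simp)
  intro d
  induction d with
  | zero =>
    rintro i rfl
    refine .loop_false ?_
    change t _ = false
    simpa using hm
  | succ d ih =>
    intro i hi
    refine .loop_true ?_ ?_ (ih (i + 1) (by omega))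
    · change t _ = true
      simpa using ht i (by omega)
    · have := exec_right (x := x) (S := S)
        (f := fun _ w => (.stay, w.map g, .right, w.bind out))
        (fun r j => if j < i then g (fun r => T r j) r else T r j)
        (fun r j => if j < i + 1 then g (fun r => T r j) r else T r j) p i
        (o ++ (List.range i).flatMap fun j => (out fun r => T r j).toList)
        (out fun r => T r i)
        (by
          intro r j hj
          have : j < i + 1 ↔ j < i := by omega
          simp only [this])
        (by intro _; simp) (by omega)
      rwa [List.append_assoc, show (List.range i).flatMap (fun j => (out fun r => T r j).toList) ++
        (out fun r => T r i).toList = (List.range (i + 1)).flatMap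
          fun j => (out fun r => T r j).toList from by simp [List.range_succ]] at this

/-- The case of `exec_sweep` without output. -/
theorem exec_sweep_silent {t : (R → Option Bool) → Bool}
    {g : (R → Option Bool) → R → Option Bool} (T : R → ℕ → Option Bool) (p m : ℕ)
    (o : List (Option Bool)) (ht : ∀ j < m, t (fun r => T r j) = true)
    (hm : t (fun r => T r m) = false) (hS : m + 1 ≤ S) :
    Prog.Exec x S (sweep t g fun _ => none) (onTracks T p 1 o)
      (onTracks (fun r j => if j < m then g (fun r => T r j) r else T r j) p (m + 1) o) := by
  have h := exec_sweep (x := x) (g := g) (out := fun _ => none) T p m o ht hm hS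
  have e : ((List.range m).flatMap fun _ : ℕ => (none : Option (Option Bool)).toList) = [] :=
    List.flatMap_eq_nil_iff.2 fun _ _ => rfl
  rwa [e, List.append_nil] at h

end RegProg

/-! ### Programs with binary registers -/

namespace RegProg

variable {R : Type}

/-- Add one to a register. -/
def inc [DecidableEq R] (r : R) : RegProg R :=
  .seq (sweep (fun c => c r == some true) (fun c => Function.update c r (some false))
      fun _ => none)
    (.seq (.act fun _ w => (.stay, w.map fun c => Function.update c r (some true), .right, none))
      home)

/-- Set a register to zero. -/
def zero [DecidableEq R] (r : R) : RegProg R :=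
  .seq (sweep (fun c => (c r).isSome) (fun c => Function.update c r none) fun _ => none) home

/-- Output the word for the content of a register. -/
def print (r : R) : RegProg R :=
  .seq (sweep (fun c => (c r).isSome) id fun c => (c r).map some)
    (.seq (.act fun _ w => (.stay, w, .right, some none)) home)

/-- Move to the first column that shows whether two registers are equal. -/
def goDiff (a b : R) : RegProg R :=
  sweep (fun c => c a == c b && (c a).isSome) id fun _ => none

/-- If the registers `a` and `b` are equal then run `A`, else run `B`. -/
def ifEq (a b : R) (A B : RegProg R) : RegProg R :=
  .seq (goDiff a b) (.cond (fun _ w => entry a w == entry b w) (.seq home A) (.seq home B))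

/-- While the registers `a` and `b` are different, run `A`. -/
def whileNe (a b : R) (A : RegProg R) : RegProg R :=
  .seq (goDiff a b)
    (.seq (.loop (fun _ w => !(entry a w == entry b w)) (.seq home (.seq A (goDiff a b)))) home)

/-- `RunsAt x B c v p v' p' l`: if all registers are at most `B`, then the program `c` turns
the register contents `v` and the input position `p` into `v'` and `p'` within space logarithmic in
`B`, outputs `l`, and keeps all registers at most `B`. -/
def RunsAt (x : List (Option Bool)) (B : ℕ) (c : RegProg R) (v : R → ℕ) (p : ℕ) (v' : R → ℕ)
    (p' : ℕ) (l : List (Option Bool)) : Prop :=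
  (∀ r, v r ≤ B) → (∀ r, v' r ≤ B) ∧
    ∀ o, Prog.Exec x (B.size + 3) c (regs v p o) (regs v' p' (o ++ l))

variable {x : List (Option Bool)} {B : ℕ}

theorem RunsAt.seq {c c' : RegProg R} {v v₁ v₂ : R → ℕ} {p p₁ p₂ : ℕ} {l l' : List (Option Bool)}
    (h : RunsAt x B c v p v₁ p₁ l) (h' : RunsAt x B c' v₁ p₁ v₂ p₂ l') :
    RunsAt x B (.seq c c') v p v₂ p₂ (l ++ l') := by
  intro hv
  obtain ⟨hv₁, h1⟩ := h hv
  obtain ⟨hv₂, h2⟩ := h' hv₁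
  refine ⟨hv₂, fun o => .seq (h1 o) ?_⟩
  rw [← List.append_assoc]
  exact h2 _

theorem length_bits_le {n : ℕ} (h : n ≤ B) : n.bits.length ≤ B.size := by
  rw [Nat.size_eq_bits_len n]
  exact Nat.size_le_size h

theorem tracks_update [DecidableEq R] (v : R → ℕ) (r : R) (n : ℕ) :
    tracks (Function.update v r n) = Function.update (tracks v) r fun j => n.bits[j]? := by
  funext s j
  rcases eq_or_ne s r with rfl | hs
  · simp [tracks]
  · simp [tracks, hs]

theorem runsAt_inc [DecidableEq R] {r : R} {v : R → ℕ} {p : ℕ} (hr : (∀ r, v r ≤ B) → v r < B) :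
    RunsAt x B (inc r) v p (Function.update v r (v r + 1)) p [] := by
  intro hv
  have hlen := length_bits_le (hv r)
  have hc := carryPos_le (v r).bits
  constructor
  · intro s
    rcases eq_or_ne s r with rfl | hs
    · simpa using hr hv
    · simpa [hs] using hv s
  intro o
  refine .seq (exec_sweep_silent (tracks v) p (carryPos (v r).bits) o ?_ ?_ (by omega)) (.seq
    (exec_right _ (tracks (Function.update v r (v r + 1))) p _ _ none ?_ ?_ (by omega)) ?_)
  · intro j hj
    simpa [tracks] using getElem?_of_lt_carryPos _ _ hj
  · simpa [tracks] using getElem?_carryPos (v r).bits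
  · intro s j hj
    rw [tracks_update]
    rcases eq_or_ne s r with rfl | hs
    · simp [bits_succ, incBits_getElem?, hj, tracks]
    · simp [hs]
  · intro i
    simp only [lt_self_iff_false, if_false, Option.map_some, Prod.mk.injEq, Option.some.injEq,
      true_and, and_true]
    funext s
    rw [tracks_update]
    rcases eq_or_ne s r with rfl | hs
    · simp [bits_succ, incBits_getElem?]
    · simp [hs]
  · have := exec_home (x := x) (S := B.size + 3) (tracks (Function.update v r (v r + 1))) p
      (carryPos (v r).bits + 2) o (by omega) (by omega)
    simpa [regs] using this

theorem runsAt_zero [DecidableEq R] {r : R} {v : R → ℕ} {p : ℕ} :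
    RunsAt x B (zero r) v p (Function.update v r 0) p [] := by
  intro hv
  have hlen := length_bits_le (hv r)
  constructor
  · intro s
    rcases eq_or_ne s r with rfl | hs
    · simp
    · simpa [hs] using hv s
  intro o
  refine .seq (exec_sweep_silent (tracks v) p (v r).bits.length o ?_ ?_ (by omega)) ?_
  · intro j hj
    simpa [tracks] using hj
  · simp [tracks]
  · have := exec_home (x := x) (S := B.size + 3) (tracks (Function.update v r 0)) p
      ((v r).bits.length + 1) o (by omega) (by omega)
    rw [regs]
    convert this using 2
    · funext s j
      rw [tracks_update]
      rcases eq_or_ne s r with rfl | hs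
      · by_cases hj : j < (v s).bits.length
        · simp [hj]
        · simp [hj, tracks]
      · simp [hs]
    · simp

theorem encodeNats_singleton (n : ℕ) : encodeNats [n] = n.bits.map some ++ [none] := by
  simp [encodeNats]

theorem encodeNats_append (l l' : List ℕ) :
    encodeNats (l ++ l') = encodeNats l ++ encodeNats l' := by
  simp [encodeNats]

theorem runsAt_print {r : R} {v : R → ℕ} {p : ℕ} :
    RunsAt x B (print r) v p v p (encodeNats [v r]) := by
  intro hv
  have hlen := length_bits_le (hv r)
  refine ⟨hv, fun o => ?_⟩
  refine .seq (exec_sweep (tracks v) p (v r).bits.length o ?_ ?_ (by omega))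
    (.seq (exec_right _ (tracks v) p _ _ (some none) ?_ ?_ (by omega)) ?_)
  · intro j hj
    simpa [tracks] using hj
  · simp [tracks]
  · intro s j _
    simp
  · intro i
    simp
  · have := exec_home (x := x) (S := B.size + 3) (tracks v) p
      ((v r).bits.length + 2) (o ++ encodeNats [v r]) (by omega) (by omega)
    rw [regs]
    convert this using 2
    have key : ∀ l : List Bool, (List.range l.length).flatMap
        (fun j => (Option.map some l[j]?).toList) = l.map some := by
      intro l
      induction l with
      | nil => rfl
      | cons b l ih => simpa [List.range_succ_eq_map, List.flatMap_map] using ih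
    have e : (List.range (v r).bits.length).flatMap
        (fun j => (Option.map some (tracks v r j)).toList) = (v r).bits.map some := key _
    rw [encodeNats_singleton, e, List.append_assoc]
    rfl

/-- The store after `goDiff`. -/
def atDiff (a b : R) (v : R → ℕ) (p : ℕ) (o : List (Option Bool)) :
    Store (Cell R) (Option Bool) :=
  onTracks (tracks v) p (diffPos (v a).bits (v b).bits + 1) o

theorem exec_goDiff {a b : R} {v : R → ℕ} (hv : ∀ r, v r ≤ B) (p : ℕ) (o : List (Option Bool)) :
    Prog.Exec x (B.size + 3) (goDiff a b) (regs v p o) (atDiff a b v p o) := by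
  have hlen := length_bits_le (hv a)
  have hd := diffPos_le (v a).bits (v b).bits
  have := exec_sweep_silent (x := x) (S := B.size + 3) (g := id)
    (t := fun c => c a == c b && (c a).isSome) (tracks v) p
    (diffPos (v a).bits (v b).bits) o ?_ ?_ (by omega)
  · simpa [atDiff, goDiff, regs] using this
  · intro j hj
    simpa [tracks] using getElem?_of_lt_diffPos _ _ _ hj
  · have := (getElem?_diffPos (v a).bits (v b).bits).2
    rw [Bool.eq_false_iff]
    simpa [tracks] using this

theorem exec_home_atDiff {a b : R} {v : R → ℕ} (hv : ∀ r, v r ≤ B) (p : ℕ)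
    (o : List (Option Bool)) :
    Prog.Exec x (B.size + 3) home (atDiff a b v p o) (regs v p o) := by
  have hlen := length_bits_le (hv a)
  have hd := diffPos_le (v a).bits (v b).bits
  exact exec_home _ _ _ _ (by omega) (by omega)

/-- After `goDiff` the scanned column shows whether the two registers are equal. -/
theorem test_atDiff (a b : R) (v : R → ℕ) (p : ℕ) (o : List (Option Bool)) :
    (entry a (atDiff a b v p o).scan == entry b (atDiff a b v p o).scan) =
      decide (v a = v b) := by
  have := (getElem?_diffPos (v a).bits (v b).bits).1
  change (tracks v a _ == tracks v b _) = _
  rw [Bool.eq_iff_iff, beq_iff_eq, decide_eq_true_iff, tracks, tracks, this]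
  exact ⟨bits_inj, fun h => by rw [h]⟩

theorem runsAt_ifEq_of_eq {a b : R} {c c' : RegProg R} {v v' : R → ℕ} {p p' : ℕ}
    {l : List (Option Bool)} (e : v a = v b) (h : RunsAt x B c v p v' p' l) :
    RunsAt x B (ifEq a b c c') v p v' p' l := by
  intro hv
  obtain ⟨hv', h1⟩ := h hv
  exact ⟨hv', fun o => .seq (exec_goDiff hv p o) (.cond_true (by rw [test_atDiff]; simpa using e)
    (.seq (exec_home_atDiff hv p o) (h1 o)))⟩

theorem runsAt_ifEq_of_ne {a b : R} {c c' : RegProg R} {v v' : R → ℕ} {p p' : ℕ}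
    {l : List (Option Bool)} (e : v a ≠ v b) (h : RunsAt x B c' v p v' p' l) :
    RunsAt x B (ifEq a b c c') v p v' p' l := by
  intro hv
  obtain ⟨hv', h1⟩ := h hv
  exact ⟨hv', fun o => .seq (exec_goDiff hv p o) (.cond_false (by rw [test_atDiff]; simpa using e)
    (.seq (exec_home_atDiff hv p o) (h1 o)))⟩

/-- Iterations of the body `c` of the loop `whileNe a b c`, until `a` and `b` are equal. -/
inductive IterAt (x : List (Option Bool)) (B : ℕ) (a b : R) (c : RegProg R) :
    (R → ℕ) → ℕ → (R → ℕ) → ℕ → List (Option Bool) → Prop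
  | done {v p} (h : v a = v b) : IterAt x B a b c v p v p []
  | step {v p v₁ p₁ v₂ p₂ l l'} (h : v a ≠ v b) (h₁ : RunsAt x B c v p v₁ p₁ l)
      (h₂ : IterAt x B a b c v₁ p₁ v₂ p₂ l') : IterAt x B a b c v p v₂ p₂ (l ++ l')

theorem IterAt.runsAt {a b : R} {c : RegProg R} {v v' : R → ℕ} {p p' : ℕ}
    {l : List (Option Bool)} (h : IterAt x B a b c v p v' p' l) :
    RunsAt x B (whileNe a b c) v p v' p' l := by
  intro hv
  suffices key : (∀ r, v' r ≤ B) ∧ ∀ o, Prog.Exec x (B.size + 3)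
      (.loop (fun _ w => !(entry a w == entry b w)) (.seq home (.seq c (goDiff a b))))
      (atDiff a b v p o) (atDiff a b v' p' (o ++ l)) from
    ⟨key.1, fun o => .seq (exec_goDiff hv p o) (.seq (key.2 o) (exec_home_atDiff key.1 _ _))⟩
  induction h with
  | done h =>
    refine ⟨hv, fun o => ?_⟩
    rw [List.append_nil]
    refine .loop_false ?_
    rw [test_atDiff]
    simpa using h
  | step h h₁ _ ih =>
    obtain ⟨hv₁, h1⟩ := h₁ hv
    obtain ⟨hv₂, h2⟩ := ih hv₁
    refine ⟨hv₂, fun o => ?_⟩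
    rw [← List.append_assoc]
    refine .loop_true ?_ (.seq (exec_home_atDiff hv _ _) (.seq (h1 o) (exec_goDiff hv₁ _ _)))
      (h2 _)
    rw [test_atDiff]
    simpa using h

/-- `RunsAt` for every position of the input head at the start and for some position at the end. -/
def Runs (x : List (Option Bool)) (B : ℕ) (c : RegProg R) (v v' : R → ℕ)
    (l : List (Option Bool)) : Prop :=
  ∀ p, ∃ p', RunsAt x B c v p v' p' l

theorem Runs.cast {c : RegProg R} {v v₁ v₂ : R → ℕ} {l l' : List (Option Bool)}
    (h : Runs x B c v v₁ l) (hv : v₁ = v₂) (hl : l = l') : Runs x B c v v₂ l' :=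
  hv ▸ hl ▸ h

theorem Runs.seq {c c' : RegProg R} {v v₁ v₂ : R → ℕ} {l l' : List (Option Bool)}
    (h : Runs x B c v v₁ l) (h' : Runs x B c' v₁ v₂ l') : Runs x B (.seq c c') v v₂ (l ++ l') := by
  intro p
  obtain ⟨p₁, h1⟩ := h p
  obtain ⟨p₂, h2⟩ := h' p₁
  exact ⟨p₂, h1.seq h2⟩

/-- The case of `Runs.seq` in which the first program outputs nothing. -/
theorem Runs.step {c c' : RegProg R} {v₁ v v₂ : R → ℕ} {l : List (Option Bool)}
    (h : Runs x B c v v₁ []) (h' : Runs x B c' v₁ v₂ l) : Runs x B (.seq c c') v v₂ l :=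
  Runs.seq h h'

theorem runs_inc [DecidableEq R] {r : R} {v : R → ℕ} (hr : v r < B) :
    Runs x B (inc r) v (Function.update v r (v r + 1)) [] :=
  fun p => ⟨p, runsAt_inc fun _ => hr⟩

theorem runs_zero [DecidableEq R] {r : R} {v : R → ℕ} :
    Runs x B (zero r) v (Function.update v r 0) [] :=
  fun p => ⟨p, runsAt_zero⟩

theorem runs_print {r : R} {v : R → ℕ} : Runs x B (print r) v v (encodeNats [v r]) :=
  fun p => ⟨p, runsAt_print⟩

theorem runs_ifEq {a b : R} {c c' : RegProg R} {v v' : R → ℕ} {l : List (Option Bool)}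
    (h : v a = v b → Runs x B c v v' l) (h' : v a ≠ v b → Runs x B c' v v' l) :
    Runs x B (ifEq a b c c') v v' l := by
  intro p
  by_cases e : v a = v b
  · obtain ⟨p', h1⟩ := h e p
    exact ⟨p', runsAt_ifEq_of_eq e h1⟩
  · obtain ⟨p', h1⟩ := h' e p
    exact ⟨p', runsAt_ifEq_of_ne e h1⟩

/-- Do nothing. -/
def skip : RegProg R := .act fun _ w => (.stay, w, .stay, none)

theorem runs_skip {v : R → ℕ} : Runs x B skip v v [] := by
  refine fun p => ⟨p, fun hv => ⟨hv, fun o => ?_⟩⟩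
  have e := Store.apply_stay x (regs v p o)
  have h : Prog.Exec x (B.size + 3) skip (regs v p o)
      ((regs v p o).apply x (.stay, (regs v p o).scan, .stay, none)) := by
    refine .act ?_
    rw [e]
    change |((1 : ℕ) : ℤ)| ≤ _
    rw [Nat.abs_cast]
    exact_mod_cast (by omega : 1 ≤ B.size + 3)
  rw [e] at h
  simpa using h

/-- Iterations of the body `c` of the loop `whileNe a b c`, until `a` and `b` are equal. -/
def Iter (x : List (Option Bool)) (B : ℕ) (a b : R) (c : RegProg R) (v v' : R → ℕ)
    (l : List (Option Bool)) : Prop :=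
  ∀ p, ∃ p', IterAt x B a b c v p v' p' l

theorem Iter.done {a b : R} {c : RegProg R} {v : R → ℕ} (h : v a = v b) : Iter x B a b c v v [] :=
  fun p => ⟨p, .done h⟩

theorem Iter.step {a b : R} {c : RegProg R} {v v₁ v₂ : R → ℕ} {l l' : List (Option Bool)}
    (h : v a ≠ v b) (h₁ : Runs x B c v v₁ l) (h₂ : Iter x B a b c v₁ v₂ l') :
    Iter x B a b c v v₂ (l ++ l') := by
  intro p
  obtain ⟨p₁, h1⟩ := h₁ p
  obtain ⟨p₂, h2⟩ := h₂ p₁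
  exact ⟨p₂, .step h h1 h2⟩

theorem Iter.runs {a b : R} {c : RegProg R} {v v' : R → ℕ} {l : List (Option Bool)}
    (h : Iter x B a b c v v' l) : Runs x B (whileNe a b c) v v' l := by
  intro p
  obtain ⟨p', h'⟩ := h p
  exact ⟨p', h'.runsAt⟩

/-- Copy the content of the register `s` to the register `r`. -/
def copy [DecidableEq R] (r s : R) : RegProg R := .seq (zero r) (whileNe r s (inc r))

theorem runs_copy [DecidableEq R] {r s : R} {v : R → ℕ} (hrs : r ≠ s) (hs : v s ≤ B) :
    Runs x B (copy r s) v (Function.update v r (v s)) [] := by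
  have key : ∀ d k, k + d = v s → Iter x B r s (inc r) (Function.update v r k)
      (Function.update v r (v s)) [] := by
    intro d
    induction d with
    | zero =>
      rintro k hk
      rw [← hk]
      exact .done (by simp [hrs.symm, ← hk])
    | succ d ih =>
      intro k hk
      refine Iter.step (l := []) (by simp [hrs.symm]; omega) (runs_inc (by simp; omega)) ?_
      simpa using ih (k + 1) (by omega)
  exact runs_zero.seq (key (v s) 0 (by simp)).runs

/-! ### Reading the input -/

/-- Whether an input cell is the left end marker. -/
def isLeftEnd : InputCell (Option Bool) → Bool
  | .leftEnd => true
  | _ => false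

/-- Whether an input cell holds the letter `a`. -/
def isLetter (a : Option Bool) : InputCell (Option Bool) → Bool
  | .letter b => b == a
  | _ => false

/-- The number by which registers represent an input symbol; `none` is the end of the input. -/
def symCode : Option (Option Bool) → ℕ
  | some (some false) => 0
  | some (some true) => 1
  | some none => 2
  | none => 3

theorem symCode_injective : Function.Injective symCode := by decide

/-- Move the input head. -/
def moveIn (m : Move) : RegProg R := .act fun _ w => (m, w, .stay, none)

/-- Store the code of the input symbol number `r` in the register `s`. The register `tmp` counts the
moves of the input head. -/
def load [DecidableEq R] (tmp r s : R) : RegProg R :=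
  .seq (.loop (fun i _ => !isLeftEnd i) (moveIn .left))
    (.seq (moveIn .right)
    (.seq (whileNe tmp r (.seq (moveIn .right) (inc tmp)))
    (.seq (zero tmp)
    (.seq (zero s)
    (.cond (fun i _ => isLetter (some false) i) skip
    (.cond (fun i _ => isLetter (some true) i) (inc s)
    (.cond (fun i _ => isLetter none i) (.seq (inc s) (inc s))
      (.seq (inc s) (.seq (inc s) (inc s))))))))))

theorem exec_moveIn {S : ℕ} (hS : 1 ≤ S) (m : Move) (v : R → ℕ) (p : ℕ) (o : List (Option Bool)) :
    Prog.Exec x S (moveIn m) (regs v p o) (regs v (Transducer.moveInput x p m) o) := by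
  have e : (regs v p o).apply x (m, (regs v p o).scan, .stay, none) =
      regs v (Transducer.moveInput x p m) o :=
    Store.ext rfl (Function.update_eq_self _ _) rfl (List.append_nil _)
  rw [← e]
  refine .act ?_
  rw [e]
  change |((1 : ℕ) : ℤ)| ≤ S
  rw [Nat.abs_cast]
  exact_mod_cast hS

theorem runsAt_moveIn (m : Move) (v : R → ℕ) (p : ℕ) :
    RunsAt x B (moveIn m) v p v (Transducer.moveInput x p m) [] := by
  refine fun hv => ⟨hv, fun o => ?_⟩
  rw [List.append_nil]
  exact exec_moveIn (by omega) m v p o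

theorem readInput_succ (x : List (Option Bool)) (k : ℕ) :
    Transducer.readInput x (k + 1) = x[k]?.elim .rightEnd .letter := by
  simp only [Transducer.readInput]
  cases x[k]? <;> rfl

theorem runsAt_rewind (v : R → ℕ) (p : ℕ) :
    RunsAt x B (.loop (fun i _ => !isLeftEnd i) (moveIn .left)) v p v 0 [] := by
  refine fun hv => ⟨hv, fun o => ?_⟩
  rw [List.append_nil]
  induction p with
  | zero => exact .loop_false rfl
  | succ p ih =>
    refine .loop_true ?_ (exec_moveIn (by omega) .left v (p + 1) o) ih
    change (!isLeftEnd (Transducer.readInput x (p + 1))) = true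
    rw [readInput_succ]
    cases x[p]? <;> rfl

theorem runsAt_condInput {t : InputCell (Option Bool) → Bool} {c c' : RegProg R} {v v' : R → ℕ}
    {p p' : ℕ} {l : List (Option Bool)}
    (h : t (Transducer.readInput x p) = true → RunsAt x B c v p v' p' l)
    (h' : t (Transducer.readInput x p) = false → RunsAt x B c' v p v' p' l) :
    RunsAt x B (.cond (fun i _ => t i) c c') v p v' p' l := by
  intro hv
  cases ht : t (Transducer.readInput x p) with
  | true => exact ⟨(h ht hv).1, fun o => .cond_true ht ((h ht hv).2 o)⟩
  | false => exact ⟨(h' ht hv).1, fun o => .cond_false ht ((h' ht hv).2 o)⟩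

theorem readInput_min (x : List (Option Bool)) (k : ℕ) :
    Transducer.readInput x (min (k + 1) (x.length + 1)) = x[k]?.elim .rightEnd .letter := by
  rcases Nat.lt_or_ge k x.length with h | h
  · rw [Nat.min_eq_left (by omega), readInput_succ]
  · rw [Nat.min_eq_right (by omega), readInput_succ]
    simp [h]

/-- The input head ends at position `v r + 1`, or at the right end marker if the input has no symbol
number `v r`. -/
theorem runs_load [DecidableEq R] {tmp r s : R} {v : R → ℕ} (h0 : v tmp = 0) (hr : tmp ≠ r)
    (hB : v r ≤ B) (hB3 : 3 ≤ B) :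
    Runs x B (load tmp r s) v (Function.update v s (symCode x[v r]?)) [] := by
  have key : ∀ d k, k + d = v r → IterAt x B tmp r (.seq (moveIn .right) (inc tmp))
      (Function.update v tmp k) (min (k + 1) (x.length + 1)) (Function.update v tmp (v r))
      (min (v r + 1) (x.length + 1)) [] := by
    intro d
    induction d with
    | zero =>
      rintro k hk
      rw [← hk]
      exact .done (by simp [hr.symm, ← hk])
    | succ d ih =>
      intro k hk
      refine IterAt.step (l := []) (by simp [hr.symm]; omega)
        ((runsAt_moveIn .right _ _).seq (runsAt_inc fun _ => by simp; omega)) ?_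
      rw [Function.update_self, Function.update_idem]
      have e : Transducer.moveInput x (min (k + 1) (x.length + 1)) .right =
          min (k + 1 + 1) (x.length + 1) := by
        simp only [Transducer.moveInput]
        omega
      rw [e]
      exact ih (k + 1) (by omega)
  have hiter := (key (v r) 0 (by simp)).runsAt
  rw [show Function.update v tmp 0 = v from by rw [← h0, Function.update_eq_self]] at hiter
  intro p
  refine ⟨min (v r + 1) (x.length + 1), (runsAt_rewind v p).seq ((runsAt_moveIn .right v 0).seq
    (hiter.seq (runsAt_zero.seq (runsAt_zero.seq ?_))))⟩
  rw [Function.update_idem,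
    show Function.update v tmp 0 = v from by rw [← h0, Function.update_eq_self]]
  have inc1 : ∀ k, k < 3 → RunsAt x B (inc s) (Function.update v s k)
      (min (v r + 1) (x.length + 1)) (Function.update v s (k + 1))
      (min (v r + 1) (x.length + 1)) [] := by
    intro k hk
    have := runsAt_inc (x := x) (B := B) (r := s) (v := Function.update v s k)
      (p := min (v r + 1) (x.length + 1)) (fun _ => by simp; omega)
    simpa using this
  have hskip : ∀ v : R → ℕ, ∀ p, RunsAt x B skip v p v p [] := fun v p => runsAt_moveIn .stay v p
  have inc2 := (inc1 0 (by omega)).seq (inc1 1 (by omega))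
  have inc3 := (inc1 0 (by omega)).seq ((inc1 1 (by omega)).seq (inc1 2 (by omega)))
  have hin := readInput_min x (v r)
  generalize min (v r + 1) (x.length + 1) = p' at *
  refine runsAt_condInput (fun h1 => ?_) fun h1 => runsAt_condInput (fun h2 => ?_) fun h2 =>
    runsAt_condInput (fun h3 => ?_) fun h3 => ?_
  all_goals rw [hin] at *; clear hin; revert h1
  all_goals try revert h2
  all_goals try revert h3
  all_goals
    rcases x[v r]? with _ | _ | _ | _ <;> simp [isLetter]
  all_goals
    first | exact hskip _ _ | exact inc1 0 (by omega) | exact inc2 | exact inc3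

/-! ### Printing tables -/

/-- The program `c` outputs the word for the list `l` and leaves the registers unchanged. -/
def Emits (x : List (Option Bool)) (B : ℕ) (c : RegProg R) (v : R → ℕ) (l : List ℕ) : Prop :=
  Runs x B c v v (encodeNats l)

theorem Emits.seq {c c' : RegProg R} {v : R → ℕ} {l l' : List ℕ} (h : Emits x B c v l)
    (h' : Emits x B c' v l') : Emits x B (.seq c c') v (l ++ l') :=
  (Runs.seq h h').cast rfl (encodeNats_append _ _).symm

/-- Run `c` for all values of the register `r` below the content of `m`. -/
def forRange [DecidableEq R] (r m : R) (c : RegProg R) : RegProg R :=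
  .seq (whileNe r m (.seq c (inc r))) (zero r)

/-- A loop that counts the register `r` up to the content of `m` outputs the words for `g k`, for all
values `k` of `r` in turn. -/
theorem runs_countUp [DecidableEq R] {r m : R} {c : RegProg R} {v : R → ℕ} {g : ℕ → List ℕ}
    (hrm : r ≠ m) (hr : v r ≤ v m) (hm : v m ≤ B)
    (h : ∀ k < v m, v r ≤ k → Emits x B c (Function.update v r k) (g k)) :
    Runs x B (whileNe r m (.seq c (inc r))) v (Function.update v r (v m))
      (encodeNats ((List.range' (v r) (v m - v r)).flatMap g)) := by
  have key : ∀ d k, k + d = v m → v r ≤ k → Iter x B r m (.seq c (inc r)) (Function.update v r k)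
      (Function.update v r (v m)) (encodeNats ((List.range' k d).flatMap g)) := by
    intro d
    induction d with
    | zero =>
      rintro k hk -
      rw [← hk]
      exact .done (by simp [hrm.symm, ← hk])
    | succ d ih =>
      intro k hk hrk
      have hbody := Runs.seq (h k (by omega) hrk) (runs_inc (x := x) (B := B) (r := r)
        (v := Function.update v r k) (by simp; omega))
      rw [Function.update_self, Function.update_idem, List.append_nil] at hbody
      have := Iter.step (by simp [hrm.symm]; omega) hbody (ih (k + 1) (by omega) (by omega))
      rwa [← encodeNats_append] at this
  have := (key (v m - v r) (v r) (by omega) le_rfl).runs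
  rwa [Function.update_eq_self] at this

theorem emits_forRange [DecidableEq R] {r m : R} {c : RegProg R} {v : R → ℕ} {g : ℕ → List ℕ}
    (hrm : r ≠ m) (h0 : v r = 0) (hm : v m ≤ B)
    (h : ∀ k < v m, Emits x B c (Function.update v r k) (g k)) :
    Emits x B (forRange r m c) v ((List.range (v m)).flatMap g) := by
  refine ((runs_countUp hrm (by omega) hm fun k hk _ => h k hk).seq (runs_zero (r := r))).cast ?_ ?_
  · rw [Function.update_idem, ← h0, Function.update_eq_self]
  · rw [List.append_nil, h0, Nat.sub_zero, List.range_eq_range']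

/-- If all pairs of registers in the list are equal then run `c`, else run `c'`. -/
def ifAll : List (R × R) → RegProg R → RegProg R → RegProg R
  | [], c, _ => c
  | (a, b) :: l, c, c' => ifEq a b (ifAll l c c') c'

theorem emits_ifAll (q : List (R × R)) {c c' : RegProg R} {v : R → ℕ} {a b : ℕ}
    (h : Emits x B c v [a]) (h' : Emits x B c' v [b]) :
    Emits x B (ifAll q c c') v [if ∀ r ∈ q, v r.1 = v r.2 then a else b] := by
  induction q with
  | nil => simpa [ifAll] using h
  | cons r q ih =>
    obtain ⟨r₁, r₂⟩ := r
    refine runs_ifEq (fun e => ?_) fun e => ?_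
    · change Emits x B _ v _
      simpa only [List.forall_mem_cons, e, true_and] using ih
    · change Emits x B _ v _
      simpa [e] using h'

end RegProg

/-! ### The tables of the operations as lists of numbers -/

/-- The table of a binary operation, where the first argument varies fastest. -/
def table₂ (N : ℕ) (g : ℕ → ℕ → ℕ) : List ℕ :=
  (List.range N).flatMap fun y => (List.range N).flatMap fun x => [g x y]

/-- The table of a ternary operation, where the first argument varies fastest. -/
def table₃ (N : ℕ) (g : ℕ → ℕ → ℕ → ℕ) : List ℕ :=
  (List.range N).flatMap fun z => (List.range N).flatMap fun y =>
    (List.range N).flatMap fun x => [g x y z]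

theorem flatMap_range_mul {α : Type} (a b : ℕ) (F : ℕ → List α) :
    (List.range (a * b)).flatMap F =
      (List.range b).flatMap fun j => (List.range a).flatMap fun i => F (i + a * j) := by
  induction b with
  | zero => simp
  | succ b ih =>
    rw [Nat.mul_succ, List.range_add, List.flatMap_append, ih, List.range_succ,
      List.flatMap_append, List.flatMap_map]
    simp [Nat.add_comm]

theorem ofFn_eq_flatMap_range {α : Type} {n : ℕ} {f : Fin n → α} {F : ℕ → α}
    (h : ∀ j : Fin n, f j = F j) : List.ofFn f = (List.range n).flatMap fun j => [F j] := by
  rw [← List.map_eq_flatMap, ← List.map_coe_finRange_eq_range, List.map_map, List.ofFn_eq_map]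
  exact List.map_congr_left fun j _ => h j

theorem flatMap_range_congr {α : Type} {n : ℕ} {F G : ℕ → List α} (h : ∀ i < n, F i = G i) :
    (List.range n).flatMap F = (List.range n).flatMap G :=
  List.flatMap_congr fun i hi => h i (List.mem_range.1 hi)

namespace SatAlgebra

theorem opCode_binary {N : ℕ} {g : Fin N → Fin N → Fin N} {G : ℕ → ℕ → ℕ}
    (h : ∀ a b, (g a b).val = G a b) : TableAlgebra.opCode (binary g) = 2 :: table₂ N G := by
  unfold TableAlgebra.opCode
  congr 1
  rw [ofFn_eq_flatMap_range (F := fun j => G (j % N) (j / N % N))]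
  · rw [show N ^ (binary g).1 = N * N from pow_two N, flatMap_range_mul]
    refine flatMap_range_congr fun y hy => flatMap_range_congr fun x hx => ?_
    rw [Nat.add_mul_mod_self_left, Nat.mod_eq_of_lt hx, Nat.add_mul_div_left _ _ (by omega),
      Nat.div_eq_of_lt hx, Nat.zero_add, Nat.mod_eq_of_lt hy]
  · intro j
    refine (h _ _).trans ?_
    change G (j / N ^ 0 % N) (j / N ^ 1 % N) = _
    simp

theorem opCode_ternary {N : ℕ} {g : Fin N → Fin N → Fin N → Fin N} {G : ℕ → ℕ → ℕ → ℕ}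
    (h : ∀ a b c, (g a b c).val = G a b c) :
    TableAlgebra.opCode (ternary g) = 3 :: table₃ N G := by
  unfold TableAlgebra.opCode
  congr 1
  rw [ofFn_eq_flatMap_range (F := fun j => G (j % N) (j / N % N) (j / N / N % N))]
  · rw [show N ^ (ternary g).1 = N * (N * N) from by change N ^ 3 = _; ring, flatMap_range_mul,
      flatMap_range_mul]
    refine flatMap_range_congr fun z hz => flatMap_range_congr fun y hy =>
      flatMap_range_congr fun x hx => ?_
    rw [Nat.add_mul_mod_self_left, Nat.mod_eq_of_lt hx, Nat.add_mul_div_left _ _ (by omega),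
      Nat.div_eq_of_lt hx, Nat.zero_add, Nat.add_mul_mod_self_left, Nat.mod_eq_of_lt hy,
      Nat.add_mul_div_left _ _ (by omega), Nat.div_eq_of_lt hy, Nat.zero_add, Nat.mod_eq_of_lt hz]
  · intro j
    refine (h _ _ _).trans ?_
    change G (j / N ^ 0 % N) (j / N ^ 1 % N) (j / N ^ 2 % N) = _
    simp [pow_two, Nat.div_div_eq_div_mul]

/-- The operation `s_i` on the numbers of the elements, where `u` is the number of `w_i`. -/
def sVal (u x y : ℕ) : ℕ := if x = y then x else if x = 0 ∧ y = 1 then u else 1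

/-- The operation `t_j` on the numbers of the elements, where `u` and `s` give the variables and the
signs of the literals. -/
def tVal (s u : Fin 3 → ℕ) (x y z : ℕ) : ℕ :=
  if x = y ∧ y = z then x
  else if s 0 = 1 ∧ y = u 0 ∧ z = u 0 ∧ x = 1 then u 0
  else if s 1 = 1 ∧ x = u 1 ∧ z = u 1 ∧ y = 1 then u 1
  else if s 2 = 1 ∧ x = u 2 ∧ y = u 2 ∧ z = 1 then u 2
  else if s 0 = 0 ∧ x = u 0 ∧ y = 0 ∧ z = 0 then 0
  else if s 1 = 0 ∧ y = u 1 ∧ x = 0 ∧ z = 0 then 0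
  else if s 2 = 0 ∧ z = u 2 ∧ x = 0 ∧ y = 0 then 0
  else 1

/-- The operation `d_1` on the numbers of the elements. -/
def d₁Val (x y z : ℕ) : ℕ := if x = y then x else if x = z then x else 1

/-- The operation `d_2` on the numbers of the elements. -/
def d₂Val (x y z : ℕ) : ℕ := if y = z then z else if x = z then z else 1

variable {n : ℕ}

theorem val_s (i : Fin n) (a b : Fin (n + 2)) : (s i a b).val = sVal (i + 2) a b := by
  unfold s sVal
  simp only [Fin.ext_iff, Fin.val_zero, Fin.val_one]
  split_ifs <;> rfl

theorem val_t (cl : Clause (Fin n)) (a b c : Fin (n + 2)) :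
    (t cl a b c).val =
      tVal (fun i => (cl i).pos.toNat) (fun i => (cl i).var + 2) a b c := by
  have hp : ∀ i, (cl i).pos = true ↔ (cl i).pos.toNat = 1 := fun i => by cases (cl i).pos <;> simp
  have hn : ∀ i, (cl i).pos = false ↔ (cl i).pos.toNat = 0 := fun i => by cases (cl i).pos <;> simp
  have hw : ∀ i : Fin n, (w i).val = i + 2 := fun i => rfl
  unfold t tVal
  simp only [Fin.ext_iff, Fin.val_zero, Fin.val_one, hp, hn, hw, apply_ite Fin.val]

theorem val_d₁ (a b c : Fin (n + 2)) : (d₁ a b c).val = d₁Val a b c := by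
  unfold d₁ d₁Val
  simp only [Fin.ext_iff]
  split_ifs <;> first | rfl | omega

theorem val_d₂ (a b c : Fin (n + 2)) : (d₂ a b c).val = d₂Val a b c := by
  unfold d₂ d₂Val
  simp only [Fin.ext_iff]
  split_ifs <;> first | rfl | omega

/-- The word for the algebra of a formula, where `w_i` has the number `i + 2`. -/
theorem flatMap_opCode (ψ : ThreeCNF (Fin n)) :
    (satAlgebra ψ).ops.flatMap TableAlgebra.opCode =
      ((List.range' 2 n).flatMap fun u => 2 :: table₂ (n + 2) (sVal u)) ++
      ((ψ.flatMap fun cl => 3 :: table₃ (n + 2)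
        (tVal (fun i => (cl i).pos.toNat) (fun i => (cl i).var + 2))) ++
      ((3 :: table₃ (n + 2) d₁Val) ++ (3 :: table₃ (n + 2) d₂Val))) := by
  change List.flatMap (TableAlgebra.opCode (N := n + 2)) (List.ofFn (fun i => binary (s i)) ++
    ψ.map (fun cl => ternary (t cl)) ++ [ternary d₁, ternary d₂]) = _
  rw [List.flatMap_append, List.flatMap_append, List.append_assoc]
  congr 1
  · rw [List.ofFn_eq_map, List.flatMap_map, List.range'_eq_map_range, List.flatMap_map,
      ← List.map_coe_finRange_eq_range, List.flatMap_map]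
    refine List.flatMap_congr fun i _ => ?_
    rw [Nat.add_comm 2, opCode_binary (val_s i)]
  · congr 1
    · rw [List.flatMap_map]
      exact List.flatMap_congr fun cl _ => opCode_ternary (val_t cl)
    · rw [List.flatMap_cons, List.flatMap_singleton, opCode_ternary val_d₁, opCode_ternary val_d₂]

end SatAlgebra

/-! ### Positions of variables in the input -/

/-- The word for the number `k`, followed by a separator, occurs at position `a` of `x`. -/
def OccursAt (x : List (Option Bool)) (k a : ℕ) : Prop :=
  ∃ r, x.drop a = k.bits.map some ++ none :: r

/-- The first position of `x` at which the word for `k` occurs. -/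
noncomputable def firstPos (x : List (Option Bool)) (k : ℕ) : ℕ := sInf {a | OccursAt x k a}

namespace OccursAt

variable {x : List (Option Bool)} {k a b : ℕ}

theorem unique {k' : ℕ} (h : OccursAt x k a) (h' : OccursAt x k' a) : k = k' := by
  obtain ⟨r, hr⟩ := h
  obtain ⟨r', hr'⟩ := h'
  exact bits_inj (append_none_inj (hr.symm.trans hr')).1

theorem firstPos_occursAt (h : OccursAt x k a) : OccursAt x k (firstPos x k) :=
  Nat.sInf_mem (s := {a | OccursAt x k a}) ⟨a, h⟩

theorem firstPos_le (h : OccursAt x k a) : firstPos x k ≤ a := Nat.sInf_le h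

theorem getElem?_of_lt (h : OccursAt x k a) {i : ℕ} (hi : i < k.bits.length) :
    x[a + i]? = some (some k.bits[i]) := by
  obtain ⟨r, hr⟩ := h
  rw [← List.getElem?_drop, hr, List.getElem?_append_left (by simpa using hi)]
  simp [hi]

theorem getElem?_length (h : OccursAt x k a) : x[a + k.bits.length]? = some none := by
  obtain ⟨r, hr⟩ := h
  rw [← List.getElem?_drop, hr, List.getElem?_append_right (by simp)]
  simp

theorem lt_length (h : OccursAt x k a) : a + k.bits.length < x.length :=
  (List.getElem?_eq_some_iff.1 h.getElem?_length).1

/-- A position that agrees with an occurrence of `k` up to the separator is an occurrence. -/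
theorem of_agree (h : OccursAt x k a) (hb : ∀ i ≤ k.bits.length, x[b + i]? = x[a + i]?) :
    OccursAt x k b := by
  refine ⟨x.drop (b + k.bits.length + 1), List.ext_getElem? fun i => ?_⟩
  rw [List.getElem?_drop]
  rcases lt_trichotomy i k.bits.length with hi | rfl | hi
  · rw [hb i hi.le, h.getElem?_of_lt hi, List.getElem?_append_left (by simpa using hi)]
    simp [hi]
  · rw [hb _ le_rfl, h.getElem?_length, List.getElem?_append_right (by simp)]
    simp
  · rw [List.getElem?_append_right (by simpa using hi.le), List.length_map]
    obtain ⟨j, rfl⟩ := Nat.exists_eq_add_of_lt hi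
    rw [show k.bits.length + j + 1 - k.bits.length = j + 1 from by omega,
      List.getElem?_cons_succ, List.getElem?_drop]
    congr 1
    omega

end OccursAt

/-! ### The program of the reduction -/

/-- The registers of the reduction. -/
inductive Reg where
  /-- The counter of the moves of the input head in `load`. -/
  | tmp
  /-- The registers `zero`, `one`, `two`, `three` hold these constants. -/
  | zero
  | one
  | two
  | three
  /-- The size of the universe. -/
  | card
  /-- The registers `x`, `y`, `z` hold the arguments of an operation whose table is printed. -/
  | x
  | y
  | z
  /-- The position of the input from which the formula is still to be read. -/
  | pos
  /-- The registers `symA`, `symB` hold codes of input symbols. -/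
  | symA
  | symB
  /-- The candidate for the first position of a variable. -/
  | cand
  /-- The position that is compared, in the word at `cand`. -/
  | curA
  /-- The position that is compared, in the word at `pos`. -/
  | curB
  /-- A flag: whether the search for a first position has ended. -/
  | found
  /-- The signs of the literals of the current clause. -/
  | sgn (k : Fin 3)
  /-- The elements of the universe that belong to the variables of the current clause. -/
  | idx (k : Fin 3)
  deriving DecidableEq, Fintype

namespace Reduction

open RegProg SatAlgebra

/-- Output the arity `2` and the table of the binary operation that `c` computes. -/
def printTable₂ (c : RegProg Reg) : RegProg Reg :=
  .seq (print .two) (forRange .y .card (forRange .x .card c))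

/-- Output the arity `3` and the table of the ternary operation that `c` computes. -/
def printTable₃ (c : RegProg Reg) : RegProg Reg :=
  .seq (print .three) (forRange .z .card (forRange .y .card (forRange .x .card c)))

/-- Output the value of the operation `s_i`, where `idx 0` holds `w_i`. -/
def printS : RegProg Reg :=
  ifAll [(.x, .y)] (print .x) (ifAll [(.x, .zero), (.y, .one)] (print (.idx 0)) (print .one))

/-- Output the value of the operation `t_j` for the clause in the registers `sgn` and `idx`. -/
def printT : RegProg Reg :=
  ifAll [(.x, .y), (.y, .z)] (print .x) <|
  ifAll [(.sgn 0, .one), (.y, .idx 0), (.z, .idx 0), (.x, .one)] (print (.idx 0)) <|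
  ifAll [(.sgn 1, .one), (.x, .idx 1), (.z, .idx 1), (.y, .one)] (print (.idx 1)) <|
  ifAll [(.sgn 2, .one), (.x, .idx 2), (.y, .idx 2), (.z, .one)] (print (.idx 2)) <|
  ifAll [(.sgn 0, .zero), (.x, .idx 0), (.y, .zero), (.z, .zero)] (print .zero) <|
  ifAll [(.sgn 1, .zero), (.y, .idx 1), (.x, .zero), (.z, .zero)] (print .zero) <|
  ifAll [(.sgn 2, .zero), (.z, .idx 2), (.x, .zero), (.y, .zero)] (print .zero) <|
  print .one

/-- Output the value of the operation `d_1`. -/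
def printD₁ : RegProg Reg :=
  ifAll [(.x, .y)] (print .x) (ifAll [(.x, .z)] (print .x) (print .one))

/-- Output the value of the operation `d_2`. -/
def printD₂ : RegProg Reg :=
  ifAll [(.y, .z)] (print .z) (ifAll [(.x, .z)] (print .z) (print .one))

/-- One step of the search for the first occurrence of the word at `pos`: compare one symbol of the
word at `cand` with one symbol of the word at `pos`. -/
def searchStep : RegProg Reg :=
  .seq (load .tmp .curA .symA) <| .seq (load .tmp .curB .symB) <|
  ifEq .symA .symB
    (ifEq .symA .two (inc .found) (.seq (inc .curA) (inc .curB)))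
    (.seq (inc .cand) (.seq (copy .curA .cand) (copy .curB .pos)))

/-- Read the sign of a literal at the position `pos` of the input, store it in `sgn k`, and move `pos`
to the word for the variable. -/
def readSign (k : Fin 3) : RegProg Reg :=
  .seq (load .tmp .pos .symA) <|
  .seq (ifEq .symA .one (.seq (inc (.sgn k)) (inc .pos)) skip) (inc .pos)

/-- Move `pos` to the next separator. -/
def skipWord : RegProg Reg :=
  .seq (load .tmp .pos .symB) (whileNe .symB .two (.seq (inc .pos) (load .tmp .pos .symB)))

/-- Read a literal at the position `pos` of the input: store its sign in `sgn k` and the element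
that belongs to its variable in `idx k`, and move `pos` past the literal. -/
def readLiteral (k : Fin 3) : RegProg Reg :=
  .seq (readSign k) <|
  .seq (copy .curB .pos) <|
  .seq (whileNe .found .one searchStep) <|
  .seq (copy (.idx k) .cand) <| .seq (inc (.idx k)) <| .seq (inc (.idx k)) <|
  .seq (zero .cand) <| .seq (zero .curA) <| .seq (zero .curB) <| .seq (zero .found) <|
  .seq skipWord <| .seq (inc .pos) <| .seq (zero .symA) (zero .symB)

/-- Read a clause and output the table of its operation. -/
def clauseStep : RegProg Reg :=
  .seq (zero .symA) <|
  .seq (readLiteral 0) <| .seq (readLiteral 1) <| .seq (readLiteral 2) <|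
  .seq (printTable₃ printT) <|
  .seq (zero (.sgn 0)) <| .seq (zero (.sgn 1)) <| .seq (zero (.sgn 2)) <|
  .seq (zero (.idx 0)) <| .seq (zero (.idx 1)) <| .seq (zero (.idx 2)) <|
  load .tmp .pos .symA

/-- Store the constants, and the size of the universe, which is three more than the length of the
input. -/
def setup : RegProg Reg :=
  .seq (inc .one) <| .seq (inc .two) <| .seq (inc .two) <|
  .seq (inc .three) <| .seq (inc .three) <| .seq (inc .three) <|
  .seq (load .tmp .card .symA) <|
  .seq (whileNe .symA .three (.seq (inc .card) (load .tmp .card .symA))) <|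
  .seq (zero .symA) <| .seq (inc .card) <| .seq (inc .card) (inc .card)

/-- Output the algebra of the formula and the element `0`. -/
def main : RegProg Reg :=
  .seq setup <| .seq (print .card) <| .seq (print .zero) <|
  .seq (copy (.idx 0) .two) <|
  .seq (whileNe (.idx 0) .card (.seq (printTable₂ printS) (inc (.idx 0)))) <|
  .seq (zero (.idx 0)) <|
  .seq (load .tmp .pos .symA) <|
  .seq (whileNe .symA .three clauseStep) <|
  .seq (zero .symA) <|
  .seq (printTable₃ printD₁) (printTable₃ printD₂)

/-- The register contents between the parts of the program. -/
def mem (c P : ℕ) (s u : Fin 3 → ℕ) : Reg → ℕ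
  | .one => 1
  | .two => 2
  | .three => 3
  | .card => c
  | .pos => P
  | .sgn k => s k
  | .idx k => u k
  | _ => 0

/-- The register contents `v` with other contents of the registers for reading literals. -/
def withSearch (v : Reg → ℕ) (a b c d e f : ℕ) : Reg → ℕ
  | .symA => a
  | .symB => b
  | .cand => c
  | .curA => d
  | .curB => e
  | .found => f
  | r => v r

variable {x : List (Option Bool)} {B : ℕ}

/-! ### Printing the operations -/

theorem emits_print (r : Reg) (v : Reg → ℕ) : Emits x B (print r) v [v r] := runs_print

theorem emits_printTable₂ {c : RegProg Reg} {v : Reg → ℕ} {g : ℕ → ℕ → ℕ} (h2 : v .two = 2)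
    (hx : v .x = 0) (hy : v .y = 0) (hc : v .card ≤ B)
    (h : ∀ a b, Emits x B c (Function.update (Function.update v .y b) .x a) [g a b]) :
    Emits x B (printTable₂ c) v (2 :: table₂ (v .card) g) := by
  have e : Emits x B (print .two) v [2] := by simpa [h2] using emits_print .two v
  refine e.seq (emits_forRange (by simp) hy hc fun b _ => ?_)
  have := emits_forRange (x := x) (B := B) (r := Reg.x) (m := .card) (c := c)
    (v := Function.update v .y b) (g := fun a => [g a b]) (by simp) (by simpa using hx)
    (by simpa using hc) fun a _ => h a b
  simpa using this

theorem emits_printTable₃ {c : RegProg Reg} {v : Reg → ℕ} {g : ℕ → ℕ → ℕ → ℕ} (h3 : v .three = 3)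
    (hx : v .x = 0) (hy : v .y = 0) (hz : v .z = 0) (hc : v .card ≤ B)
    (h : ∀ a b d, Emits x B c
      (Function.update (Function.update (Function.update v .z d) .y b) .x a) [g a b d]) :
    Emits x B (printTable₃ c) v (3 :: table₃ (v .card) g) := by
  have e : Emits x B (print .three) v [3] := by simpa [h3] using emits_print .three v
  refine e.seq (emits_forRange (by simp) hz hc fun d _ => ?_)
  have := emits_forRange (x := x) (B := B) (r := Reg.y) (m := .card) (c := forRange .x .card c)
    (v := Function.update v .z d) (g := fun b => (List.range (v .card)).flatMap fun a => [g a b d])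
    (by simp) (by simpa using hy) (by simpa using hc) fun b _ => ?_
  · simpa using this
  · have := emits_forRange (x := x) (B := B) (r := Reg.x) (m := .card) (c := c)
      (v := Function.update (Function.update v .z d) .y b) (g := fun a => [g a b d]) (by simp)
      (by simpa using hx) (by simpa using hc) fun a _ => h a b d
    simpa using this

theorem emits_printS {v : Reg → ℕ} (h0 : v .zero = 0) (h1 : v .one = 1) :
    Emits x B printS v [sVal (v (.idx 0)) (v .x) (v .y)] := by
  have := emits_ifAll (x := x) (B := B) (v := v) [(.x, .y)] (emits_print .x v)
    (emits_ifAll [(.x, .zero), (.y, .one)] (emits_print (.idx 0) v) (emits_print .one v))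
  simpa [printS, sVal, h0, h1] using this

theorem emits_printT {v : Reg → ℕ} (h0 : v .zero = 0) (h1 : v .one = 1) :
    Emits x B printT v
      [tVal (fun k => v (.sgn k)) (fun k => v (.idx k)) (v .x) (v .y) (v .z)] := by
  have := emits_ifAll (x := x) (B := B) (v := v) [(.x, .y), (.y, .z)] (emits_print .x v)
    (emits_ifAll [(.sgn 0, .one), (.y, .idx 0), (.z, .idx 0), (.x, .one)] (emits_print (.idx 0) v)
    (emits_ifAll [(.sgn 1, .one), (.x, .idx 1), (.z, .idx 1), (.y, .one)] (emits_print (.idx 1) v)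
    (emits_ifAll [(.sgn 2, .one), (.x, .idx 2), (.y, .idx 2), (.z, .one)] (emits_print (.idx 2) v)
    (emits_ifAll [(.sgn 0, .zero), (.x, .idx 0), (.y, .zero), (.z, .zero)] (emits_print .zero v)
    (emits_ifAll [(.sgn 1, .zero), (.y, .idx 1), (.x, .zero), (.z, .zero)] (emits_print .zero v)
    (emits_ifAll [(.sgn 2, .zero), (.z, .idx 2), (.x, .zero), (.y, .zero)] (emits_print .zero v)
    (emits_print .one v)))))))
  simpa only [List.forall_mem_cons, List.not_mem_nil, false_imp_iff, implies_true, and_true, h0, h1,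
    printT, tVal] using this

theorem emits_printD₁ {v : Reg → ℕ} (h1 : v .one = 1) :
    Emits x B printD₁ v [d₁Val (v .x) (v .y) (v .z)] := by
  have := emits_ifAll (x := x) (B := B) (v := v) [(.x, .y)] (emits_print .x v)
    (emits_ifAll [(.x, .z)] (emits_print .x v) (emits_print .one v))
  simpa [printD₁, d₁Val, h1] using this

theorem emits_printD₂ {v : Reg → ℕ} (h1 : v .one = 1) :
    Emits x B printD₂ v [d₂Val (v .x) (v .y) (v .z)] := by
  have := emits_ifAll (x := x) (B := B) (v := v) [(.y, .z)] (emits_print .z v)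
    (emits_ifAll [(.x, .z)] (emits_print .z v) (emits_print .one v))
  simpa [printD₂, d₂Val, h1] using this

/-! ### Searching for the first occurrence of a word -/

section withSearch

variable (v : Reg → ℕ) (a b c d e f k : ℕ)

theorem withSearch_symA : Function.update (withSearch v a b c d e f) .symA k =
    withSearch v k b c d e f := by
  funext r; cases r <;> simp [withSearch]

theorem withSearch_symB : Function.update (withSearch v a b c d e f) .symB k =
    withSearch v a k c d e f := by
  funext r; cases r <;> simp [withSearch]

theorem withSearch_cand : Function.update (withSearch v a b c d e f) .cand k =
    withSearch v a b k d e f := by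
  funext r; cases r <;> simp [withSearch]

theorem withSearch_curA : Function.update (withSearch v a b c d e f) .curA k =
    withSearch v a b c k e f := by
  funext r; cases r <;> simp [withSearch]

theorem withSearch_curB : Function.update (withSearch v a b c d e f) .curB k =
    withSearch v a b c d k f := by
  funext r; cases r <;> simp [withSearch]

theorem withSearch_found : Function.update (withSearch v a b c d e f) .found k =
    withSearch v a b c d e k := by
  funext r; cases r <;> simp [withSearch]

theorem withSearch_pos : Function.update (withSearch v a b c d e f) .pos k =
    withSearch (Function.update v .pos k) a b c d e f := by
  funext r; cases r <;> simp [withSearch]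

theorem withSearch_sgn (i : Fin 3) : Function.update (withSearch v a b c d e f) (.sgn i) k =
    withSearch (Function.update v (.sgn i) k) a b c d e f := by
  funext r; cases r <;> simp [withSearch, Function.update_apply]

theorem withSearch_idx (i : Fin 3) : Function.update (withSearch v a b c d e f) (.idx i) k =
    withSearch (Function.update v (.idx i) k) a b c d e f := by
  funext r; cases r <;> simp [withSearch, Function.update_apply]

end withSearch

section search

variable {v : Reg → ℕ} {a b c d e f : ℕ}

/-- The two symbols that a step of the search compares are loaded. -/
theorem runs_compare (h0 : v .tmp = 0) (hd : d ≤ B) (he : e ≤ B) (hB : 3 ≤ B)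
    {A : RegProg Reg} {v' : Reg → ℕ} {l : List (Option Bool)}
    (h : Runs x B A (withSearch v (symCode x[d]?) (symCode x[e]?) c d e f) v' l) :
    Runs x B (.seq (load .tmp .curA .symA) (.seq (load .tmp .curB .symB) A))
      (withSearch v a b c d e f) v' l := by
  refine (runs_load (tmp := Reg.tmp) (v := withSearch v a b c d e f) (r := Reg.curA) h0 (by simp) hd hB).seq ?_
  rw [withSearch_symA]
  refine (runs_load (tmp := Reg.tmp) (v := withSearch v _ b c d e f) (r := Reg.curB) h0 (by simp) he hB).seq ?_
  rw [withSearch_symB]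
  exact h

/-- The last symbols agree: an occurrence is found. -/
theorem runs_searchStep_found (h0 : v .tmp = 0) (h2 : v .two = 2) (hd : d < B) (he : e < B)
    (hB : 3 ≤ B) (h : x[d]? = x[e]?) (hn : x[e]? = some none) :
    Runs x B searchStep (withSearch v a b c d e 0) (withSearch v 2 2 c d e 1) [] := by
  refine runs_compare h0 hd.le he.le hB (runs_ifEq (fun _ => runs_ifEq (fun _ => ?_) fun hne => ?_)
    fun hne => ?_)
  · rw [h, hn]
    exact (runs_inc (by simp [withSearch]; omega)).cast (withSearch_found ..) rfl
  · refine absurd ?_ hne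
    simp [withSearch, h, hn, symCode, h2]
  · refine absurd ?_ hne
    simp [withSearch, h]

/-- The symbols agree: continue with the next symbols. -/
theorem runs_searchStep_match (h0 : v .tmp = 0) (h2 : v .two = 2) (hd : d < B) (he : e < B)
    (hB : 3 ≤ B) (h : x[d]? = x[e]?) (hn : x[e]? ≠ some none) :
    Runs x B searchStep (withSearch v a b c d e 0)
      (withSearch v (symCode x[d]?) (symCode x[e]?) c (d + 1) (e + 1) 0) [] := by
  refine runs_compare h0 hd.le he.le hB (runs_ifEq (fun _ => runs_ifEq (fun h' => ?_) fun _ => ?_)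
    fun hne => ?_)
  · refine absurd (symCode_injective ?_) hn
    rw [← h]
    exact h'.trans h2
  · refine ((runs_inc hd).cast (withSearch_curA ..) rfl).seq
      ((runs_inc he).cast (withSearch_curB ..) rfl)
  · refine absurd ?_ hne
    simp [withSearch, h]

/-- The symbols differ: continue with the next candidate. -/
theorem runs_searchStep_mismatch (h0 : v .tmp = 0) (hc : c < B) (hd : d < B) (he : e < B)
    (hB : 3 ≤ B) (hp : v .pos ≤ B) (h : x[d]? ≠ x[e]?) :
    Runs x B searchStep (withSearch v a b c d e 0)
      (withSearch v (symCode x[d]?) (symCode x[e]?) (c + 1) (c + 1) (v .pos) 0) [] := by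
  refine runs_compare h0 hd.le he.le hB (runs_ifEq (fun h' => ?_) fun _ => ?_)
  · exact absurd (symCode_injective h') h
  · refine ((runs_inc hc).cast (withSearch_cand ..) rfl).seq
      (((runs_copy (by simp) ?_).cast (withSearch_curA ..) rfl).seq
      ((runs_copy (by simp) ?_).cast (withSearch_curB ..) rfl))
    · exact hc
    · exact hp

/-- The search ends at the first occurrence of the word for `k`. The induction is on the distance of
the candidate from it and on the number of symbols that are still to be compared. -/
theorem iter_search {k : ℕ} (hk : OccursAt x k (v .pos)) (h0 : v .tmp = 0) (h1 : v .one = 1)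
    (h2 : v .two = 2) (hB : x.length + 3 ≤ B) :
    ∀ da c, c + da = firstPos x k → ∀ dj j, j + dj = k.bits.length →
      (∀ i < j, x[c + i]? = x[v .pos + i]?) → ∀ a b,
      Iter x B .found .one searchStep (withSearch v a b c (c + j) (v .pos + j) 0)
        (withSearch v 2 2 (firstPos x k) (firstPos x k + k.bits.length)
          (v .pos + k.bits.length) 1) [] := by
  have hlt := hk.lt_length
  have hle := hk.firstPos_le
  intro da
  induction da with
  | zero =>
    rintro c hc dj
    have hcand : OccursAt x k c := by
      rw [show c = firstPos x k from hc]
      exact hk.firstPos_occursAt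
    induction dj with
    | zero =>
      rintro j rfl hagree a b
      refine Iter.step (l := []) (by simp [withSearch, h1]) (runs_searchStep_found h0 h2
        (by omega) (by omega) (by omega) ?_ hk.getElem?_length) ?_
      · rw [hcand.getElem?_length, hk.getElem?_length]
      · rw [show c = firstPos x k from hc]
        exact .done (by simp [withSearch, h1])
    | succ dj ih =>
      intro j hj hagree a b
      have he : x[c + j]? = x[v .pos + j]? := by
        rw [hcand.getElem?_of_lt (by omega), hk.getElem?_of_lt (by omega)]
      refine Iter.step (l := []) (by simp [withSearch, h1]) (runs_searchStep_match h0 h2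
        (by omega) (by omega) (by omega) he ?_) (ih (j + 1) (by omega) (fun i hi => ?_) _ _)
      · rw [hk.getElem?_of_lt (by omega)]
        simp
      · rcases Nat.lt_succ_iff_lt_or_eq.1 hi with hi | rfl
        · exact hagree i hi
        · exact he
  | succ da iha =>
    intro c hc dj
    have miss : ∀ j ≤ k.bits.length, x[c + j]? ≠ x[v .pos + j]? → ∀ a b,
        Iter x B .found .one searchStep (withSearch v a b c (c + j) (v .pos + j) 0)
        (withSearch v 2 2 (firstPos x k) (firstPos x k + k.bits.length)
          (v .pos + k.bits.length) 1) [] := by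
      intro j hj hne a b
      refine Iter.step (l := []) (by simp [withSearch, h1]) (runs_searchStep_mismatch h0
        (by omega) (by omega) (by omega) (by omega) (by omega) hne) ?_
      exact iha (c + 1) (by omega) k.bits.length 0 (by omega) (by simp) _ _
    induction dj with
    | zero =>
      rintro j rfl hagree a b
      refine miss _ le_rfl (fun he => ?_) a b
      have := (hk.of_agree (b := c) fun i hi => ?_).firstPos_le
      · omega
      · rcases hi.lt_or_eq with hi | rfl
        · exact hagree i hi
        · exact he
    | succ dj ih =>
      intro j hj hagree a b
      by_cases he : x[c + j]? = x[v .pos + j]?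
      · refine Iter.step (l := []) (by simp [withSearch, h1]) (runs_searchStep_match h0 h2
          (by omega) (by omega) (by omega) he ?_) (ih (j + 1) (by omega) (fun i hi => ?_) _ _)
        · rw [hk.getElem?_of_lt (by omega)]
          simp
        · rcases Nat.lt_succ_iff_lt_or_eq.1 hi with hi | rfl
          · exact hagree i hi
          · exact he
      · exact miss j (by omega) he a b

theorem runs_skipWord {k P : ℕ} (hk : OccursAt x k P) (h0 : v .tmp = 0) (h2 : v .two = 2)
    (hP : v .pos = P) (hB : x.length + 3 ≤ B) :
    Runs x B skipWord (withSearch v a b c d e f)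
      (withSearch (Function.update v .pos (P + k.bits.length)) a 2 c d e f) [] := by
  have hlt := hk.lt_length
  have key : ∀ dj j, j + dj = k.bits.length →
      Iter x B .symB .two (.seq (inc .pos) (load .tmp .pos .symB))
        (withSearch (Function.update v .pos (P + j)) a (symCode x[P + j]?) c d e f)
        (withSearch (Function.update v .pos (P + k.bits.length)) a 2 c d e f) [] := by
    intro dj
    induction dj with
    | zero =>
      rintro j rfl
      rw [hk.getElem?_length]
      exact .done (by simp [withSearch, symCode, h2])
    | succ dj ih =>
      intro j hj
      refine Iter.step (l := []) ?_ (Runs.seq (l := []) (l' := [])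
        ((runs_inc ?_).cast (withSearch_pos ..) rfl)
        ((runs_load ?_ (by simp) ?_ (by omega)).cast (withSearch_symB ..) rfl)) ?_
      · rw [hk.getElem?_of_lt (by omega)]
        cases k.bits[j]'(by omega) <;> simp [withSearch, symCode, h2]
      · simp [withSearch]; omega
      · simpa [withSearch] using h0
      · simp [withSearch]; omega
      · simpa [withSearch, Nat.add_assoc] using ih (j + 1) (by omega)
  refine ((runs_load (tmp := Reg.tmp) (v := withSearch v a b c d e f) (r := Reg.pos) h0 (by simp) ?_
    (by omega)).cast (withSearch_symB ..) rfl).seq ?_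
  · simp [withSearch]; omega
  · have := (key k.bits.length 0 (by simp)).runs
    rw [Nat.add_zero, ← hP, Function.update_eq_self] at this
    rw [← hP]
    exact this

end search

section mem

variable (c P : ℕ) (s u : Fin 3 → ℕ)

theorem mem_pos (k : ℕ) : Function.update (mem c P s u) .pos k = mem c k s u := by
  funext r; cases r <;> simp [mem]

theorem mem_sgn (i : Fin 3) (k : ℕ) :
    Function.update (mem c P s u) (.sgn i) k = mem c P (Function.update s i k) u := by
  funext r; cases r <;> simp [mem, Function.update_apply]

theorem mem_idx (i : Fin 3) (k : ℕ) :
    Function.update (mem c P s u) (.idx i) k = mem c P s (Function.update u i k) := by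
  funext r; cases r <;> simp [mem, Function.update_apply]

theorem withSearch_mem : withSearch (mem c P s u) 0 0 0 0 0 0 = mem c P s u := by
  funext r; cases r <;> rfl

end mem

variable {c P : ℕ} {s u : Fin 3 → ℕ}

/-! ### Reading the words of literals -/

theorem encodeNats_literalCode (l : Literal ℕ) : encodeNats (ThreeCNF.literalCode l) =
    l.pos.toNat.bits.map some ++ none :: (l.var.bits.map some ++ [none]) := by
  simp [ThreeCNF.literalCode, encodeNats]

theorem length_encodeNats_literalCode (l : Literal ℕ) :
    (encodeNats (ThreeCNF.literalCode l)).length = l.pos.toNat + 1 + l.var.bits.length + 1 := by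
  rw [encodeNats_literalCode]
  cases l.pos <;> simp <;> omega

theorem runs_readSign (k : Fin 3) {l : Literal ℕ} {r : List (Option Bool)}
    (hx : x.drop P = encodeNats (ThreeCNF.literalCode l) ++ r) (hs : s k = 0)
    (hB : x.length + 3 ≤ B) :
    Runs x B (readSign k) (mem c P s u)
      (withSearch (mem c (P + l.pos.toNat + 1) (Function.update s k l.pos.toNat) u)
        (symCode x[P]?) 0 0 0 0 0) [] := by
  have hlen := congrArg List.length hx
  rw [List.length_append, length_encodeNats_literalCode, List.length_drop] at hlen
  have hxP : x[P]? = (x.drop P)[0]? := by rw [List.getElem?_drop, Nat.add_zero]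
  rw [hx, encodeNats_literalCode] at hxP
  rw [← withSearch_mem]
  refine Runs.seq (l := []) (l' := []) ((runs_load (tmp := Reg.tmp)
    (v := withSearch (mem c P s u) 0 0 0 0 0 0) (r := Reg.pos) rfl (by simp) ?_
    (by omega)).cast (withSearch_symA ..) rfl) ?_
  · change P ≤ B
    omega
  change Runs x B _ (withSearch (mem c P s u) (symCode x[P]?) 0 0 0 0 0) _ _
  cases hpos : l.pos with
  | true =>
    rw [hpos] at hxP
    have hsym : symCode x[P]? = 1 := by simp [hxP, symCode]
    refine Runs.seq (l := []) (l' := []) (v₁ := withSearch (mem c (P + 1)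
      (Function.update s k 1) u) (symCode x[P]?) 0 0 0 0 0)
      (runs_ifEq (fun _ => ?_) fun hne => absurd hsym hne) ?_
    · refine Runs.step (v₁ := withSearch (mem c P (Function.update s k 1) u)
        (symCode x[P]?) 0 0 0 0 0) ((runs_inc ?_).cast ?_ rfl)
        ((runs_inc ?_).cast ((withSearch_pos ..).trans ?_) rfl)
      · change s k < B
        omega
      · rw [withSearch_sgn, mem_sgn]
        simp [withSearch, mem, hs]
      · change P < B
        omega
      · rw [mem_pos]
        rfl
    · refine (runs_inc ?_).cast ((withSearch_pos ..).trans ?_) rfl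
      · change P + 1 < B
        rw [hpos, Bool.toNat_true] at hlen
        omega
      · rw [mem_pos]
        rfl
  | false =>
    rw [hpos] at hxP
    have hsym : symCode x[P]? = 2 := by simp [hxP, symCode]
    rw [show Function.update s k false.toNat = s from by
      rw [Bool.toNat_false, ← hs, Function.update_eq_self]]
    refine Runs.step (runs_ifEq (fun he => ?_) fun _ => runs_skip) ?_
    · exact absurd (hsym.symm.trans he) (by simp [withSearch, mem])
    · refine (runs_inc ?_).cast ((withSearch_pos ..).trans ?_) rfl
      · change P < B
        omega
      · rw [mem_pos]
        rfl

/-- From a canonical memory, a literal is read into `sgn k` and `idx k`. The element `w_i` has the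
number `i + 2`, whence the summand `2`. -/
theorem runs_readLiteral (k : Fin 3) {l : Literal ℕ} {r : List (Option Bool)}
    (hx : x.drop P = encodeNats (ThreeCNF.literalCode l) ++ r) (hs : s k = 0)
    (hB : x.length + 3 ≤ B) :
    Runs x B (readLiteral k) (mem c P s u)
      (mem c (P + (encodeNats (ThreeCNF.literalCode l)).length)
        (Function.update s k l.pos.toNat) (Function.update u k (firstPos x l.var + 2))) [] := by
  have hocc : OccursAt x l.var (P + l.pos.toNat + 1) := by
    refine ⟨r, ?_⟩
    rw [Nat.add_assoc, ← List.drop_drop, hx, encodeNats_literalCode]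
    cases l.pos <;> simp
  have hlt := hocc.lt_length
  have hle := hocc.firstPos_le
  rw [length_encodeNats_literalCode]
  refine Runs.step (runs_readSign k hx hs hB) ?_
  rw [show P + (l.pos.toNat + 1 + l.var.bits.length + 1) =
    P + l.pos.toNat + 1 + l.var.bits.length + 1 from by omega]
  generalize Function.update s k l.pos.toNat = s'
  generalize P + l.pos.toNat + 1 = P₁ at *
  have hsearch := (iter_search (v := mem c P₁ s' u) hocc rfl rfl rfl hB _ 0 (Nat.zero_add _) _ 0
    (Nat.zero_add _) (by simp) (symCode x[P]?) 0).runs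
  have hskip := fun u' => runs_skipWord (v := mem c P₁ s' u') (a := 2) (b := 2) (c := 0) (d := 0)
    (e := 0) (f := 0) hocc rfl rfl rfl hB
  simp only [mem_pos] at hskip
  generalize firstPos x l.var = f at *
  generalize l.var.bits.length = L at *
  change Runs x B _ _ (withSearch (mem c P₁ s' u) 2 2 f (f + L) (P₁ + L) 1) [] at hsearch
  refine Runs.step (v₁ := withSearch (mem c P₁ s' u) (symCode x[P]?) 0 0 0 P₁ 0)
    ((runs_copy (by simp) ?_).cast (withSearch_curB ..) rfl) ?_
  · change P₁ ≤ B
    omega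
  refine Runs.step hsearch ?_
  refine Runs.step (v₁ := withSearch (mem c P₁ s' (Function.update u k f)) 2 2 f (f + L) (P₁ + L) 1)
    ((runs_copy (by simp) ?_).cast ?_ rfl) ?_
  · change f ≤ B
    omega
  · rw [withSearch_idx, mem_idx]
    rfl
  refine Runs.step (v₁ := withSearch (mem c P₁ s' (Function.update u k (f + 1))) 2 2 f (f + L)
    (P₁ + L) 1) ((runs_inc ?_).cast ?_ rfl) ?_
  · simp [withSearch, mem]
    omega
  · rw [withSearch_idx, mem_idx]
    simp [withSearch, mem]
  refine Runs.step (v₁ := withSearch (mem c P₁ s' (Function.update u k (f + 2))) 2 2 f (f + L)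
    (P₁ + L) 1) ((runs_inc ?_).cast ?_ rfl) ?_
  · simp [withSearch, mem]
    omega
  · rw [withSearch_idx, mem_idx]
    simp [withSearch, mem]
  generalize Function.update u k (f + 2) = u'
  refine Runs.step (runs_zero.cast (withSearch_cand ..) rfl) ?_
  refine Runs.step (runs_zero.cast (withSearch_curA ..) rfl) ?_
  refine Runs.step (runs_zero.cast (withSearch_curB ..) rfl) ?_
  refine Runs.step (runs_zero.cast (withSearch_found ..) rfl) ?_
  refine Runs.step (hskip u') ?_
  refine Runs.step (v₁ := withSearch (mem c (P₁ + L + 1) s' u') 2 2 0 0 0 0)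
    ((runs_inc ?_).cast ?_ rfl) ?_
  · change P₁ + L < B
    omega
  · rw [withSearch_pos, mem_pos]
    rfl
  refine Runs.step (runs_zero.cast (withSearch_symA ..) rfl) ?_
  exact runs_zero.cast ((withSearch_symB ..).trans (withSearch_mem ..)) rfl

/-! ### Reading clauses -/

/-- The part of the output that belongs to a clause of the formula. -/
noncomputable def clauseOutput (x : List (Option Bool)) (c : ℕ) (cl : Clause ℕ) : List ℕ :=
  3 :: table₃ c (tVal (fun i => (cl i).pos.toNat) fun i => firstPos x (cl i).var + 2)

/-- The word for a clause. -/
def clauseWord (cl : Clause ℕ) : List (Option Bool) :=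
  encodeNats (ThreeCNF.literalCode (cl 0)) ++ encodeNats (ThreeCNF.literalCode (cl 1)) ++
    encodeNats (ThreeCNF.literalCode (cl 2))

theorem encodeNats_code_cons (cl : Clause ℕ) (φ : ThreeCNF ℕ) :
    encodeNats (ThreeCNF.code (cl :: φ)) = clauseWord cl ++ encodeNats (ThreeCNF.code φ) := by
  simp only [ThreeCNF.code, List.flatMap_cons, encodeNats_append, clauseWord]

theorem runs_clauseStep {cl : Clause ℕ} {r : List (Option Bool)} {q : ℕ}
    (hx : x.drop P = clauseWord cl ++ r) (hB : x.length + 3 ≤ B) (hc : c ≤ B) :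
    Runs x B clauseStep (withSearch (mem c P (fun _ => 0) fun _ => 0) q 0 0 0 0 0)
      (withSearch (mem c (P + (clauseWord cl).length) (fun _ => 0) fun _ => 0)
        (symCode x[P + (clauseWord cl).length]?) 0 0 0 0 0)
      (encodeNats (clauseOutput x c cl)) := by
  have hlen := congrArg List.length hx
  rw [List.length_append, List.length_drop] at hlen
  have hpos : 0 < (clauseWord cl).length := by
    simp only [clauseWord, List.length_append, length_encodeNats_literalCode]
    omega
  set l₀ := encodeNats (ThreeCNF.literalCode (cl 0)) with h₀
  set l₁ := encodeNats (ThreeCNF.literalCode (cl 1)) with h₁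
  set l₂ := encodeNats (ThreeCNF.literalCode (cl 2)) with h₂
  have hx₀ : x.drop P = l₀ ++ (l₁ ++ (l₂ ++ r)) := by
    rw [hx, clauseWord, ← h₀, ← h₁, ← h₂]
    simp only [List.append_assoc]
  have hx₁ : x.drop (P + l₀.length) = l₁ ++ (l₂ ++ r) := by
    rw [← List.drop_drop, hx₀, List.drop_left]
  have hx₂ : x.drop (P + l₀.length + l₁.length) = l₂ ++ r := by
    rw [← List.drop_drop, hx₁, List.drop_left]
  have hP : P + (clauseWord cl).length = P + l₀.length + l₁.length + l₂.length := by
    simp only [clauseWord, List.length_append, ← h₀, ← h₁, ← h₂]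
    omega
  rw [hP]
  set P' := P + l₀.length + l₁.length + l₂.length
  refine Runs.step (runs_zero.cast ((withSearch_symA ..).trans (withSearch_mem ..)) rfl) ?_
  refine Runs.step (runs_readLiteral 0 hx₀ rfl hB) ?_
  refine Runs.step (runs_readLiteral 1 hx₁ rfl hB) ?_
  refine Runs.step (runs_readLiteral 2 hx₂ rfl hB) ?_
  set s : Fin 3 → ℕ := Function.update (Function.update (Function.update (fun _ => 0) 0
    (cl 0).pos.toNat) 1 (cl 1).pos.toNat) 2 (cl 2).pos.toNat with hs
  set u : Fin 3 → ℕ := Function.update (Function.update (Function.update (fun _ => 0) 0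
    (firstPos x (cl 0).var + 2)) 1 (firstPos x (cl 1).var + 2)) 2 (firstPos x (cl 2).var + 2)
    with hu
  have es : s = fun i => (cl i).pos.toNat := by
    funext i
    fin_cases i <;> simp [hs]
  have eu : u = fun i => firstPos x (cl i).var + 2 := by
    funext i
    fin_cases i <;> simp [hu]
  have htable : Emits x B (printTable₃ printT) (mem c P' s u) (clauseOutput x c cl) := by
    have := emits_printTable₃ (x := x) (B := B) (c := printT) (v := mem c P' s u)
      (g := tVal s u) rfl rfl rfl rfl hc fun a b d => ?_
    · rw [es, eu] at this
      rw [es, eu]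
      exact this
    · have := emits_printT (x := x) (B := B) (v := Function.update (Function.update
        (Function.update (mem c P' s u) .z d) .y b) .x a) (by simp [mem]) (by simp [mem])
      simpa [mem] using this
  have := Runs.seq (x := x) (B := B) htable (l' := []) (c' := .seq (zero (.sgn 0)) <|
    .seq (zero (.sgn 1)) <| .seq (zero (.sgn 2)) <| .seq (zero (.idx 0)) <|
    .seq (zero (.idx 1)) <| .seq (zero (.idx 2)) <| load .tmp .pos .symA)
    (v₂ := withSearch (mem c P' (fun _ => 0) fun _ => 0) (symCode x[P']?) 0 0 0 0 0) ?_
  · rwa [List.append_nil] at this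
  refine Runs.step (runs_zero.cast (mem_sgn ..) rfl) ?_
  refine Runs.step (runs_zero.cast (mem_sgn ..) rfl) ?_
  refine Runs.step (runs_zero.cast (mem_sgn ..) rfl) ?_
  refine Runs.step (runs_zero.cast (mem_idx ..) rfl) ?_
  refine Runs.step (runs_zero.cast (mem_idx ..) rfl) ?_
  refine Runs.step (v₁ := withSearch (mem c P' (fun _ => 0) fun _ => 0) 0 0 0 0 0 0)
    (runs_zero.cast ?_ rfl) ?_
  · rw [mem_idx, withSearch_mem]
    congr 1 <;> funext i <;> fin_cases i <;> simp
  · refine (runs_load (tmp := Reg.tmp) (v := withSearch (mem c P' (fun _ => 0) fun _ => 0)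
      0 0 0 0 0 0) (r := Reg.pos) rfl (by simp) ?_ (by omega)).cast (withSearch_symA ..) rfl
    change P' ≤ B
    omega

/-- The loop over the clauses outputs the tables of the operations `t_j`. -/
theorem iter_clauses (hB : x.length + 3 ≤ B) (hc : c ≤ B) (φ : ThreeCNF ℕ) :
    ∀ P, x.drop P = encodeNats φ.code → ∃ P', Iter x B .symA .three clauseStep
      (withSearch (mem c P (fun _ => 0) fun _ => 0) (symCode x[P]?) 0 0 0 0 0)
      (withSearch (mem c P' (fun _ => 0) fun _ => 0) 3 0 0 0 0 0)
      (encodeNats (φ.flatMap (clauseOutput x c))) := by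
  induction φ with
  | nil =>
    intro P hP
    have hx : x[P]? = none := by
      rw [show x[P]? = (x.drop P)[0]? from by rw [List.getElem?_drop, Nat.add_zero], hP]
      rfl
    refine ⟨P, ?_⟩
    rw [hx]
    exact .done rfl
  | cons cl φ ih =>
    intro P hP
    rw [encodeNats_code_cons] at hP
    obtain ⟨P', h⟩ := ih (P + (clauseWord cl).length) (by rw [← List.drop_drop, hP, List.drop_left])
    refine ⟨P', ?_⟩
    rw [List.flatMap_cons, encodeNats_append]
    refine Iter.step (fun he => ?_) (runs_clauseStep hP hB hc) h
    have hx : x[P]? = none := symCode_injective he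
    have hlen := congrArg List.length hP
    rw [List.getElem?_eq_none_iff] at hx
    simp only [clauseWord, List.length_append, length_encodeNats_literalCode,
      List.length_drop] at hlen
    omega

/-! ### The whole program -/

theorem mem_card (s u : Fin 3 → ℕ) (k : ℕ) : Function.update (mem c P s u) .card k =
    mem k P s u := by
  funext r; cases r <;> simp [mem]

theorem withSearch_card (v : Reg → ℕ) (a b c d e f k : ℕ) :
    Function.update (withSearch v a b c d e f) .card k =
    withSearch (Function.update v .card k) a b c d e f := by
  funext r; cases r <;> simp [withSearch]

/-- The length of the input is found as the first position without an input symbol. -/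
theorem runs_setup : Runs x (x.length + 3) setup (fun _ => 0)
    (mem (x.length + 3) 0 (fun _ => 0) fun _ => 0) [] := by
  set m := fun k => mem k 0 (fun _ => 0) fun _ => 0 with hm
  set B := x.length + 3 with hB
  have key : ∀ d k, k + d = x.length →
      Iter x B .symA .three (.seq (inc .card) (load .tmp .card .symA))
        (withSearch (m k) (symCode x[k]?) 0 0 0 0 0) (withSearch (m x.length) 3 0 0 0 0 0) [] := by
    intro d
    induction d with
    | zero =>
      rintro k hk
      rw [show k = x.length from hk, List.getElem?_eq_none le_rfl]
      exact .done rfl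
    | succ d ih =>
      intro k hk
      refine Iter.step (l := []) (fun he => ?_) (Runs.step (v₁ := withSearch (m (k + 1))
        (symCode x[k]?) 0 0 0 0 0) ((runs_inc ?_).cast ?_ rfl)
        ((runs_load (tmp := Reg.tmp) (v := withSearch (m (k + 1)) (symCode x[k]?) 0 0 0 0 0)
          (r := Reg.card) rfl (by simp) ?_ (by omega)).cast (withSearch_symA ..) rfl))
        (ih (k + 1) (by omega))
      · have := List.getElem?_eq_none_iff.1 (show x[k]? = none from symCode_injective he)
        omega
      · change k < B
        omega
      · rw [withSearch_card, hm, mem_card]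
        rfl
      · change k + 1 ≤ B
        omega
  refine Runs.step (runs_inc (by omega)) ?_
  refine Runs.step (runs_inc (by simp; omega)) ?_
  refine Runs.step (runs_inc (by simp; omega)) ?_
  refine Runs.step (runs_inc (by simp; omega)) ?_
  refine Runs.step (runs_inc (by simp; omega)) ?_
  refine Runs.step (v₁ := withSearch (m 0) 0 0 0 0 0 0) ((runs_inc (by simp; omega)).cast ?_ rfl) ?_
  · rw [hm, withSearch_mem]
    funext r
    cases r <;> simp [mem]
  refine Runs.step ((runs_load (tmp := Reg.tmp) (v := withSearch (m 0) 0 0 0 0 0 0)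
    (r := Reg.card) rfl (by simp) (Nat.zero_le _) (by omega)).cast (withSearch_symA ..) rfl) ?_
  refine Runs.step (key x.length 0 (Nat.zero_add _)).runs ?_
  refine Runs.step (runs_zero.cast ((withSearch_symA ..).trans (withSearch_mem ..)) rfl) ?_
  refine Runs.step ((runs_inc ?_).cast (mem_card ..) rfl) (Runs.step
    ((runs_inc ?_).cast (mem_card ..) rfl) ((runs_inc ?_).cast (mem_card ..) rfl))
  · change x.length < B
    omega
  · change x.length + 1 < B
    omega
  · change x.length + 2 < B
    omega

/-- The numbers in the output of the program. -/
noncomputable def output (φ : ThreeCNF ℕ) : List ℕ :=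
  let x := encodeNats φ.code
  let c := x.length + 3
  [c] ++ ([0] ++ (((List.range' 2 (x.length + 1)).flatMap fun u => 2 :: table₂ c (sVal u)) ++
    (φ.flatMap (clauseOutput x c) ++ ((3 :: table₃ c d₁Val) ++ (3 :: table₃ c d₂Val)))))

theorem runs_main (φ : ThreeCNF ℕ) : ∃ v, Runs (encodeNats φ.code)
    ((encodeNats φ.code).length + 3) main (fun _ => 0) v (encodeNats (output φ)) := by
  unfold output
  set x := encodeNats φ.code with hx
  set B := x.length + 3 with hB
  obtain ⟨P', hP'⟩ := iter_clauses (x := x) (B := B) (c := B) le_rfl le_rfl φ 0 hx.symm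
  set v : Reg → ℕ := mem B P' (fun _ => 0) fun _ => 0 with hv
  refine ⟨v, ?_⟩
  have hd₁ : Emits x B (printTable₃ printD₁) v (3 :: table₃ B d₁Val) := by
    refine emits_printTable₃ (v := v) rfl rfl rfl rfl le_rfl fun a b d => ?_
    have := emits_printD₁ (x := x) (B := B) (v := Function.update (Function.update
      (Function.update v .z d) .y b) .x a) (by simp [hv, mem])
    simpa [hv, mem] using this
  have hd₂ : Emits x B (printTable₃ printD₂) v (3 :: table₃ B d₂Val) := by
    refine emits_printTable₃ (v := v) rfl rfl rfl rfl le_rfl fun a b d => ?_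
    have := emits_printD₂ (x := x) (B := B) (v := Function.update (Function.update
      (Function.update v .z d) .y b) .x a) (by simp [hv, mem])
    simpa [hv, mem] using this
  simp only [encodeNats_append]
  refine Runs.step runs_setup ?_
  refine Runs.seq (emits_print _ _) (Runs.seq (emits_print _ _) ?_)
  refine Runs.step (v₁ := mem B 0 (fun _ => 0) (Function.update (fun _ => 0) 0 2))
    ((runs_copy (by simp) ?_).cast (mem_idx ..) rfl) ?_
  · change 2 ≤ B
    omega
  have hs := runs_countUp (x := x) (B := B) (r := Reg.idx 0) (m := .card)
    (c := printTable₂ printS) (v := mem B 0 (fun _ => 0) (Function.update (fun _ => 0) 0 2))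
    (g := fun u => 2 :: table₂ B (sVal u)) (by simp) (by simp [mem]; omega) (by simp [mem])
    fun k _ _ => ?_
  · rw [show mem B 0 (fun _ => 0) (Function.update (fun _ => 0) 0 2) (.idx 0) = 2 from by simp [mem],
      show mem B 0 (fun _ => 0) (Function.update (fun _ => 0) 0 2) .card - 2 = x.length + 1 from by
        simp [mem]; omega] at hs
    refine Runs.seq hs ?_
    refine Runs.step (v₁ := withSearch (mem B 0 (fun _ => 0) fun _ => 0) 0 0 0 0 0 0)
      (runs_zero.cast ?_ rfl) ?_
    · rw [mem_idx, mem_idx, withSearch_mem]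
      rw [Function.update_idem, Function.update_idem, Function.update_eq_self]
    refine Runs.step ((runs_load (tmp := Reg.tmp)
      (v := withSearch (mem B 0 (fun _ => 0) fun _ => 0) 0 0 0 0 0 0) (r := Reg.pos) rfl (by simp)
      (Nat.zero_le _) (by omega)).cast (withSearch_symA ..) rfl) ?_
    refine Runs.seq hP'.runs ?_
    refine Runs.step (runs_zero.cast ((withSearch_symA ..).trans (withSearch_mem ..)) rfl) ?_
    exact Runs.seq hd₁ hd₂
  · rw [mem_idx]
    refine emits_printTable₂ (v := mem B 0 (fun _ => 0) _) rfl rfl rfl le_rfl fun a b => ?_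
    have := emits_printS (x := x) (B := B) (v := Function.update (Function.update (mem B 0
      (fun _ => 0) (Function.update (Function.update (fun _ => 0) 0 2) 0 k)) .y b) .x a)
      (by simp [mem]) (by simp [mem])
    simpa [mem] using this

/-! ### The transducer of the reduction -/

/-- Write the marker at the origin, then run the main program. -/
def program : RegProg Reg := .seq (.act fun _ _ => (.stay, none, .right, none)) main

/-- The blank work cell. -/
def blankCell : Cell Reg := some fun _ => none

/-- The transducer that computes the reduction. -/
def transducer : Transducer (Option Bool) (Option Bool) := program.toTransducer blankCell

/-- The marker turns the blank tape into the canonical store in which all registers are zero. -/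
theorem exec_program (φ : ThreeCNF ℕ) : ∃ d : Store (Cell Reg) (Option Bool),
    Prog.Exec (encodeNats φ.code) (((encodeNats φ.code).length + 3).size + 3) program
      (Store.initial blankCell) d ∧ d.output = encodeNats (output φ) := by
  obtain ⟨v, h⟩ := runs_main φ
  obtain ⟨p, h⟩ := h 0
  refine ⟨_, .seq ?_ ((h fun _ => Nat.zero_le _).2 []), rfl⟩
  have e : (Store.initial blankCell).apply (encodeNats φ.code) (.stay, none, .right, none) =
      regs (fun _ : Reg => 0) 0 [] := by
    refine Store.ext rfl ?_ rfl rfl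
    funext z
    change Function.update (fun _ => blankCell) 0 none z = tapeOf _ z
    match z with
    | .negSucc z => rfl
    | .ofNat 0 => rfl
    | .ofNat (k + 1) =>
      rw [Function.update_of_ne (by simp; omega)]
      simp [tapeOf, tracks, blankCell]
  rw [← e]
  refine .act ?_
  change |(1 : ℤ)| ≤ _
  rw [abs_one]
  push_cast
  omega

/-- Registers with values up to `N + 3` need only logarithmic space. -/
theorem size_add_three_le (N : ℕ) : (N + 3).size + 3 ≤ 6 * Nat.log 2 N + 6 := by
  have h : (N + 3).size ≤ Nat.log 2 N + 3 := by
    rw [Nat.size_le]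
    have h1 : N < 2 ^ (Nat.log 2 N + 1) := Nat.lt_pow_succ_log_self (by norm_num) N
    have h2 : 2 ^ (Nat.log 2 N + 3) = 8 * 2 ^ Nat.log 2 N := by ring
    have h3 : 1 ≤ 2 ^ (Nat.log 2 N) := Nat.one_le_two_pow
    rw [pow_succ] at h1
    omega
  omega

/-! ### The formula with renamed variables -/

theorem exists_occursAt {l : List ℕ} {k : ℕ} (h : k ∈ l) : ∃ a, OccursAt (encodeNats l) k a := by
  obtain ⟨s, t, rfl⟩ := List.append_of_mem h
  refine ⟨(encodeNats s).length, encodeNats t, ?_⟩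
  rw [encodeNats_append, List.drop_left, encodeNats_cons]

theorem var_mem_code {φ : ThreeCNF ℕ} {cl : Clause ℕ} (h : cl ∈ φ) (i : Fin 3) :
    (cl i).var ∈ φ.code := by
  refine List.mem_flatMap.2 ⟨cl, h, ?_⟩
  fin_cases i <;> simp [ThreeCNF.literalCode]

/-- The new index of a variable: its first position in the word for the formula. Every number up to
the length of the word is the index of a variable, whether it is used or not. -/
noncomputable def index (φ : ThreeCNF ℕ) (k : ℕ) : Fin ((encodeNats φ.code).length + 1) :=
  Fin.ofNat _ (firstPos (encodeNats φ.code) k)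

/-- The formula with the new indices of its variables. -/
noncomputable def indexed (φ : ThreeCNF ℕ) :
    ThreeCNF (Fin ((encodeNats φ.code).length + 1)) :=
  φ.rename (index φ)

theorem val_index {φ : ThreeCNF ℕ} {k : ℕ} (h : k ∈ φ.code) :
    (index φ k).val = firstPos (encodeNats φ.code) k := by
  obtain ⟨a, ha⟩ := exists_occursAt h
  have h1 := ha.firstPos_le
  have h2 := ha.lt_length
  exact Nat.mod_eq_of_lt (by omega)

open Classical in
/-- The old variable with a given new index. An unused index gets a number that is larger than all
variables of the formula. -/
noncomputable def oldVar (φ : ThreeCNF ℕ) (i : Fin ((encodeNats φ.code).length + 1)) : ℕ :=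
  if h : ∃ k, OccursAt (encodeNats φ.code) k i ∧ firstPos (encodeNats φ.code) k = i then h.choose
  else 2 ^ (encodeNats φ.code).length + i

theorem oldVar_injective (φ : ThreeCNF ℕ) : Function.Injective (oldVar φ) := by
  have hlt : ∀ k a, OccursAt (encodeNats φ.code) k a → k < 2 ^ (encodeNats φ.code).length := by
    intro k a h
    have h1 := h.lt_length
    have h2 : k.bits.length = k.size := Nat.size_eq_bits_len k
    exact (Nat.lt_size_self k).trans_le (Nat.pow_le_pow_right (by norm_num) (by omega))
  intro i j hij
  unfold oldVar at hij
  split_ifs at hij with h h' h'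
  · have e := h.choose_spec.2
    rw [hij, h'.choose_spec.2] at e
    exact Fin.ext e.symm
  · have := hlt _ _ h.choose_spec.1
    omega
  · have := hlt _ _ h'.choose_spec.1
    omega
  · exact Fin.ext (by omega)

theorem oldVar_index {φ : ThreeCNF ℕ} {k : ℕ} (h : k ∈ φ.code) : oldVar φ (index φ k) = k := by
  obtain ⟨a, ha⟩ := exists_occursAt h
  have hex : ∃ k', OccursAt (encodeNats φ.code) k' (index φ k) ∧
      firstPos (encodeNats φ.code) k' = index φ k := by
    refine ⟨k, ?_, (val_index h).symm⟩
    rw [val_index h]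
    exact ha.firstPos_occursAt
  unfold oldVar
  rw [dif_pos hex]
  exact hex.choose_spec.1.unique (val_index h ▸ ha.firstPos_occursAt)

theorem rename_oldVar (φ : ThreeCNF ℕ) : φ = (indexed φ).rename (oldVar φ) := by
  unfold indexed ThreeCNF.rename
  rw [List.map_map]
  refine (List.map_id'' (fun _ => rfl) φ).symm.trans (List.map_congr_left fun cl hcl => ?_)
  funext i
  exact Literal.ext (oldVar_index (var_mem_code hcl i)).symm rfl

theorem satisfiable_rename {V V' : Type} {r : V → V'} (hr : Function.Injective r)
    (φ : ThreeCNF V) : (φ.rename r).Satisfiable ↔ φ.Satisfiable := by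
  constructor
  · rintro ⟨e, he⟩
    exact ⟨e ∘ r, fun cl hcl => he _ (List.mem_map_of_mem hcl)⟩
  · rintro ⟨e, he⟩
    refine ⟨Function.extend r e fun _ => true, fun cl' hcl' => ?_⟩
    obtain ⟨cl, hcl, rfl⟩ := List.mem_map.1 hcl'
    obtain ⟨i, hi⟩ := he cl hcl
    exact ⟨i, by simpa [hr.extend_apply] using hi⟩

theorem satisfiable_indexed (φ : ThreeCNF ℕ) : (indexed φ).Satisfiable ↔ φ.Satisfiable := by
  conv_rhs => rw [rename_oldVar φ]
  exact (satisfiable_rename (oldVar_injective φ) _).symm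

/-! ### The reduction -/

/-- The algebra of the formula with renamed variables, together with the element `0`. -/
noncomputable def reduction (φ : ThreeCNF ℕ) : SingletonBlockerInstance where
  alg := satAlgebra (indexed φ)
  b := satZero (indexed φ)
  idempotent := SatAlgebra.isIdempotentAlgebra _
  distributive := SatAlgebra.inCongruenceDistributiveVariety _

theorem code_reduction (φ : ThreeCNF ℕ) : (reduction φ).code = output φ := by
  change _ :: _ :: (satAlgebra (indexed φ)).ops.flatMap TableAlgebra.opCode = _
  rw [flatMap_opCode]
  unfold output
  have e : ((indexed φ).flatMap fun cl => 3 :: table₃ ((encodeNats φ.code).length + 1 + 2)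
      (tVal (fun i => (cl i).pos.toNat) fun i => (cl i).var + 2)) =
      φ.flatMap (clauseOutput (encodeNats φ.code) ((encodeNats φ.code).length + 3)) := by
    unfold indexed ThreeCNF.rename
    rw [List.flatMap_map]
    refine List.flatMap_congr fun cl hcl => ?_
    unfold clauseOutput
    simp only [val_index (var_mem_code hcl _)]
  rw [e]
  rfl

theorem logspaceComputable_reduction :
    LogspaceComputable threeSAT singletonBlockerProblem reduction := by
  refine ⟨transducer, 6, fun φ => ?_⟩
  obtain ⟨d, hd, ho⟩ := exec_program φ
  obtain ⟨h1, h2⟩ := hd.outputs_and_spaceBoundedBy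
  constructor
  · change Transducer.Outputs _ _ (encodeNats (reduction φ).code)
    rw [show (reduction φ).code = output φ from code_reduction φ, ← ho]
    exact h1
  · intro c hc i
    refine (h2 c hc i).trans ?_
    exact_mod_cast size_add_three_le _

theorem isLogspaceReduction_reduction :
    IsLogspaceReduction threeSAT singletonBlockerProblem reduction := by
  refine ⟨logspaceComputable_reduction, fun φ => ?_⟩
  refine (satisfiable_indexed φ).symm.trans ?_
  exact ⟨hasBlocker_of_satisfiable, satisfiable_of_hasBlocker⟩

end Reduction

theorem mainTheorem4 :
    (∀ (n : ℕ) (ψ : ThreeCNF (Fin n)),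
      IsIdempotentAlgebra (satAlgebra ψ).lang (Fin (satAlgebra ψ).card) ∧
      InCongruenceDistributiveVariety (satAlgebra ψ).lang (Fin (satAlgebra ψ).card) ∧
      (HasBlocker (satAlgebra ψ).lang ({satZero ψ} : Set (Fin (satAlgebra ψ).card)) ↔
        ψ.Satisfiable)) ∧
    ∃ f : ThreeCNF ℕ → SingletonBlockerInstance,
      IsLogspaceReduction threeSAT singletonBlockerProblem f ∧
      ∀ φ : ThreeCNF ℕ, ∃ (n : ℕ) (ψ : ThreeCNF (Fin n)) (r : Fin n → ℕ),
        Function.Injective r ∧ φ = ψ.rename r ∧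
        ∃ (hi : IsIdempotentAlgebra (satAlgebra ψ).lang (Fin (satAlgebra ψ).card))
          (hd : InCongruenceDistributiveVariety (satAlgebra ψ).lang (Fin (satAlgebra ψ).card)),
          f φ = ⟨satAlgebra ψ, satZero ψ, hi, hd⟩ := by
  refine ⟨fun n ψ => ⟨SatAlgebra.isIdempotentAlgebra ψ,
    SatAlgebra.inCongruenceDistributiveVariety ψ, SatAlgebra.satisfiable_of_hasBlocker,
    SatAlgebra.hasBlocker_of_satisfiable⟩, Reduction.reduction,
    Reduction.isLogspaceReduction_reduction, fun φ => ?_⟩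
  exact ⟨_, Reduction.indexed φ, Reduction.oldVar φ, Reduction.oldVar_injective φ,
    Reduction.rename_oldVar φ, SatAlgebra.isIdempotentAlgebra _,
    SatAlgebra.inCongruenceDistributiveVariety _, rfl⟩
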